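/- **Setting.** Let $V$ be a Hilbert space of vector fields on $\mathbb{R}^n$ that is continuously embedded in $C^2_0(\mathbb{R}^n,\mathbb{R}^n)$ (the $C^2$ fields vanishing at infinity together with their derivatives of order one and two), with reproducing kernel $K_V:\mathbb{R}^n\times\mathbb{R}^n\to\mathbb{R}^{n\times n}$, and assume that $K_V(x,x)$ is invertible for every $x$. Let $\gamma>0$. For a finite measure $\mu$ on $\mathbb{R}^n$, $v\in L^2([0,1],V)$ and $\eta\in L^2([0,1],L^2(\mu))$, let $\varphi^v_t$ be the flow $\varphi^v_t(x)=x+\int_0^t v_s(\varphi^v_s(x))\,ds$, let $\tilde\alpha^\eta_t(x)=1+\frac12\int_0^t\eta_s(x)\,ds$, let $\mu_t=\big((\tilde\alpha^\eta_t)^2\circ(\varphi^v_t)^{-1}\big)\,(\varphi^v_t)_\#\mu$, and let $$C_\mu(v,\eta)=\frac12\int_0^1\|v_t\|_V^2\,dt+\frac{\gamma}{2}\int_0^1\int_{\mathbb{R}^n}\big(\eta_t\circ(\varphi^v_t)^{-1}\big)^2\,d\big((\varphi^v_t)_\#\mu\big)\,dt .$$ The LDDMM-Fisher-Rao distance is defined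 by $d_{V-\mathcal{FR}}(\mu,\mu')^2=\inf C_\mu(v,\eta)$, the infimum being over all $(v,\eta)$ with $\mu_1=\mu'$ and $\tilde\alpha^\eta_t\ge 0$ for all $t\in[0,1]$, $\mu$-a.e. A geodesic from $\mu$ to $\mu'$ is the path $t\in[0,1]\mapsto\mu_t$ of a pair $(v,\eta)$ that attains this infimum. Let $d_{K_V}$ be the Riemannian distance on $\mathbb{R}^n$ (infimum of lengths of $C^1$ paths) of the metric $G_x(h,h)=h^TK_V(x,x)^{-1}h$; a $G$-geodesic from $x_0$ to $x_1$ is a $C^1$ curve $x:[0,1]\to\mathbb{R}^n$ with $x(0)=x_0$, $x(1)=x_1$, of constant $G$-speed and of length $d_{K_V}(x_0,x_1)$. **Proposition.** Let $x_0,x_1\in\mathbb{R}^n$, $r_0>0$ and $r_1\ge 0$; if $r_1=0$ (so that $r_1\delta_{x_1}$ is the zero measure, whatever $x_1$ is), take $x_1=x_0$. Then $d_{K_V}(x_0,x_1)$ and $d_{V-\mathcal{FR}}(r_0\delta_{x_0},r_1\delta_{x_1})$ are finite and $$d_{V-\mathcal{FR}}(r_0\delta_{x_0},r_1\delta_{x_1})^2=\frac12\,d_{K_V}(x_0,x_1)^2+2\gamma\,(\sqrt{r_1}-\sqrt{r_0})^2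 .$$ Moreover there is a $G$-geodesic from $x_0$ to $x_1$, and the geodesics from $r_0\delta_{x_0}$ to $r_1\delta_{x_1}$ for $d_{V-\mathcal{FR}}$ are exactly the paths $t\in[0,1]\mapsto r(t)\,\delta_{x(t)}$ where $x(\cdot)$ is a $G$-geodesic from $x_0$ to $x_1$ and $r(t)=\big((1-t)\sqrt{r_0}+t\sqrt{r_1}\big)^2$. -/

import Mathlib

open MeasureTheory Set Filter Topology
open scoped ENNReal Manifold

noncomputable section

/-- The Hilbert space `V` of vector fields on `ℝⁿ` (its elements are read as functions through the
injective coercion of `RKHS`) is continuously embedded in `C²₀(ℝⁿ, ℝⁿ)`: every field is `C²`,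
it vanishes at infinity together with its derivatives of order one and two, and the sup norms of
these derivatives are bounded by a constant times the norm of `V`. -/
structure EmbedsInC20 {n : ℕ} (V : Type*) [NormedAddCommGroup V] [InnerProductSpace ℝ V]
    [RKHS ℝ V (EuclideanSpace ℝ (Fin n)) (EuclideanSpace ℝ (Fin n))] : Prop where
  contDiff : ∀ u : V, ContDiff ℝ 2 (u : EuclideanSpace ℝ (Fin n) → EuclideanSpace ℝ (Fin n))
  vanish : ∀ u : V, ∀ k : ℕ, k ≤ 2 →
    Tendsto (fun x : EuclideanSpace ℝ (Fin n) =>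
      iteratedFDeriv ℝ k (u : EuclideanSpace ℝ (Fin n) → EuclideanSpace ℝ (Fin n)) x)
      (cocompact _) (𝓝 0)
  bound : ∃ c : ℝ, 0 < c ∧ ∀ u : V, ∀ k : ℕ, k ≤ 2 → ∀ x : EuclideanSpace ℝ (Fin n),
    ‖iteratedFDeriv ℝ k (u : EuclideanSpace ℝ (Fin n) → EuclideanSpace ℝ (Fin n)) x‖ ≤ c * ‖u‖

/-! ### The Riemannian metric given by the inverse of the kernel on the diagonal -/

/-- The metric `G_x(h, h') = hᵀ K_V(x, x)⁻¹ h'` on `ℝⁿ`, where `K_V` is the reproducing kernel of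
`V`. -/
def kernelMetric {n : ℕ} (V : Type*) [NormedAddCommGroup V] [InnerProductSpace ℝ V]
    [CompleteSpace V] [RKHS ℝ V (EuclideanSpace ℝ (Fin n)) (EuclideanSpace ℝ (Fin n))]
    (x h h' : EuclideanSpace ℝ (Fin n)) : ℝ :=
  inner ℝ h ((RKHS.kernel V x x).inverse h')

/-- The Riemannian length `√(G_x(h, h))` of a tangent vector `h` at `x`. -/
def kernelSpeed {n : ℕ} (V : Type*) [NormedAddCommGroup V] [InnerProductSpace ℝ V]
    [CompleteSpace V] [RKHS ℝ V (EuclideanSpace ℝ (Fin n)) (EuclideanSpace ℝ (Fin n))]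
    (x h : EuclideanSpace ℝ (Fin n)) : ℝ≥0∞ :=
  ENNReal.ofReal (√(kernelMetric V x h h))

/-- The Riemannian distance of the metric `G`: the infimum of the `G`-lengths of the `C¹` paths
from `x` to `y`. -/
def kernelEDist {n : ℕ} (V : Type*) [NormedAddCommGroup V] [InnerProductSpace ℝ V]
    [CompleteSpace V] [RKHS ℝ V (EuclideanSpace ℝ (Fin n)) (EuclideanSpace ℝ (Fin n))]
    (x y : EuclideanSpace ℝ (Fin n)) : ℝ≥0∞ :=
  letI : ∀ z : EuclideanSpace ℝ (Fin n),
      ENorm (TangentSpace 𝓘(ℝ, EuclideanSpace ℝ (Fin n)) z) := fun z => ⟨kernelSpeed V z⟩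
  Manifold.riemannianEDist 𝓘(ℝ, EuclideanSpace ℝ (Fin n)) x y

/-- `x : [0, 1] → ℝⁿ` is a (minimizing) geodesic from `x₀` to `x₁` for the metric `G`: a `C¹` curve
of constant speed whose length is the distance of its end points. -/
structure IsKernelGeodesic {n : ℕ} (V : Type*) [NormedAddCommGroup V] [InnerProductSpace ℝ V]
    [CompleteSpace V] [RKHS ℝ V (EuclideanSpace ℝ (Fin n)) (EuclideanSpace ℝ (Fin n))]
    (x₀ x₁ : EuclideanSpace ℝ (Fin n)) (x : ℝ → EuclideanSpace ℝ (Fin n)) : Prop where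
  contDiffOn : ContDiffOn ℝ 1 x (Icc 0 1)
  source : x 0 = x₀
  target : x 1 = x₁
  speed : ∀ t ∈ Icc (0 : ℝ) 1,
    kernelSpeed V (x t) (derivWithin x (Icc 0 1) t) = kernelEDist V x₀ x₁

/-! ### The LDDMM-Fisher-Rao distance between `0`-varifolds, i.e. finite measures on `ℝⁿ` -/

/-- `φ` is the flow on `[0, 1]` of the time-dependent vector field `v`:
`φ_t(x) = x + ∫₀ᵗ v_s(φ_s(x)) ds` for every `x`. -/
def IsFlow {n : ℕ} {V : Type*} [NormedAddCommGroup V] [InnerProductSpace ℝ V]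
    [RKHS ℝ V (EuclideanSpace ℝ (Fin n)) (EuclideanSpace ℝ (Fin n))]
    (v : ℝ → V) (φ : ℝ → EuclideanSpace ℝ (Fin n) ≃ₜ EuclideanSpace ℝ (Fin n)) : Prop :=
  ∀ x : EuclideanSpace ℝ (Fin n),
    IntervalIntegrable (fun s => v s (φ s x)) volume 0 1 ∧
    ∀ t ∈ Icc (0 : ℝ) 1, φ t x = x + ∫ s in (0 : ℝ)..t, v s (φ s x)

/-- `α̃_t(x) = 1 + ½ ∫₀ᵗ η_s(x) ds`, the square root of the weight change function. -/
def sqrtWeight {n : ℕ} (η : ℝ → EuclideanSpace ℝ (Fin n) → ℝ) (t : ℝ)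
    (x : EuclideanSpace ℝ (Fin n)) : ℝ :=
  1 + (1 / 2) * ∫ s in (0 : ℝ)..t, η s x

/-- The transformed measure `((α̃_t)² ∘ φ_t⁻¹) · (φ_t)_# μ`.  For measures without tangential
part the push-forward `(φ_t)_# μ` carries no Jacobian factor: it is the image measure. -/
def transformedMeasure {n : ℕ} (μ : Measure (EuclideanSpace ℝ (Fin n)))
    (φ : ℝ → EuclideanSpace ℝ (Fin n) ≃ₜ EuclideanSpace ℝ (Fin n))
    (η : ℝ → EuclideanSpace ℝ (Fin n) → ℝ) (t : ℝ) : Measure (EuclideanSpace ℝ (Fin n)) :=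
  (μ.map (φ t)).withDensity
    (fun y => ENNReal.ofReal ((sqrtWeight η t ((φ t).symm y)) ^ 2))

/-- `(v, η)` is an admissible control from `μ` to `μ'` with flow `φ`: `v ∈ L²([0,1], V)`,
`η ∈ L²([0,1], L²(μ))`, `α̃_t ≥ 0` for all `t`, `μ`-almost everywhere, and the measure
transformed up to time `1` is `μ'`. -/
structure IsAdmissible {n : ℕ} {V : Type*} [NormedAddCommGroup V] [InnerProductSpace ℝ V]
    [RKHS ℝ V (EuclideanSpace ℝ (Fin n)) (EuclideanSpace ℝ (Fin n))]
    (μ μ' : Measure (EuclideanSpace ℝ (Fin n))) (v : ℝ → V)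
    (η : ℝ → EuclideanSpace ℝ (Fin n) → ℝ)
    (φ : ℝ → EuclideanSpace ℝ (Fin n) ≃ₜ EuclideanSpace ℝ (Fin n)) : Prop where
  memLp_v : MemLp v 2 (volume.restrict (Icc (0 : ℝ) 1))
  memLp_η : MemLp (fun p : ℝ × EuclideanSpace ℝ (Fin n) => η p.1 p.2) 2
    ((volume.restrict (Icc (0 : ℝ) 1)).prod μ)
  flow : IsFlow v φ
  nonneg : ∀ᵐ x ∂μ, ∀ t ∈ Icc (0 : ℝ) 1, 0 ≤ sqrtWeight η t x
  target : transformedMeasure μ φ η 1 = μ'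

/-- The cost `½ ∫₀¹ ‖v_t‖²_V dt + (γ/2) ∫₀¹ ∫ (η_t ∘ φ_t⁻¹)² d((φ_t)_# μ) dt`. -/
def lddmmFRCost {n : ℕ} {V : Type*} [NormedAddCommGroup V] (γ : ℝ)
    (μ : Measure (EuclideanSpace ℝ (Fin n))) (v : ℝ → V)
    (η : ℝ → EuclideanSpace ℝ (Fin n) → ℝ)
    (φ : ℝ → EuclideanSpace ℝ (Fin n) ≃ₜ EuclideanSpace ℝ (Fin n)) : ℝ≥0∞ :=
  ENNReal.ofReal (1 / 2) * (∫⁻ t in Icc (0 : ℝ) 1, ‖v t‖ₑ ^ 2) +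
    ENNReal.ofReal (γ / 2) *
      ∫⁻ t in Icc (0 : ℝ) 1, ∫⁻ y, ‖η t ((φ t).symm y)‖ₑ ^ 2 ∂(μ.map (φ t))

/-- The LDDMM-Fisher-Rao distance: the square root of the infimum of the cost over all admissible
controls from `μ` to `μ'` (`∞` if there is none). -/
def lddmmFREDist {n : ℕ} (V : Type*) [NormedAddCommGroup V] [InnerProductSpace ℝ V]
    [RKHS ℝ V (EuclideanSpace ℝ (Fin n)) (EuclideanSpace ℝ (Fin n))] (γ : ℝ)
    (μ μ' : Measure (EuclideanSpace ℝ (Fin n))) : ℝ≥0∞ :=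
  (⨅ (v : ℝ → V) (η : ℝ → EuclideanSpace ℝ (Fin n) → ℝ)
    (φ : ℝ → EuclideanSpace ℝ (Fin n) ≃ₜ EuclideanSpace ℝ (Fin n))
    (_ : IsAdmissible μ μ' v η φ), lddmmFRCost γ μ v η φ) ^ (1 / 2 : ℝ)

/-- A path of measures `t ∈ [0, 1] ↦ m t` is a geodesic from `μ` to `μ'` for the LDDMM-Fisher-Rao
distance: it is the path of transformed measures of an optimal control. -/
def IsLDDMMFRGeodesic {n : ℕ} (V : Type*) [NormedAddCommGroup V] [InnerProductSpace ℝ V]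
    [RKHS ℝ V (EuclideanSpace ℝ (Fin n)) (EuclideanSpace ℝ (Fin n))] (γ : ℝ)
    (μ μ' : Measure (EuclideanSpace ℝ (Fin n)))
    (m : ℝ → Measure (EuclideanSpace ℝ (Fin n))) : Prop :=
  ∃ (v : ℝ → V) (η : ℝ → EuclideanSpace ℝ (Fin n) → ℝ)
    (φ : ℝ → EuclideanSpace ℝ (Fin n) ≃ₜ EuclideanSpace ℝ (Fin n)),
    IsAdmissible μ μ' v η φ ∧
    lddmmFREDist V γ μ μ' = (lddmmFRCost γ μ v η φ) ^ (1 / 2 : ℝ) ∧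
    ∀ t ∈ Icc (0 : ℝ) 1, m t = transformedMeasure μ φ η t

end

/-!
For a multiple of a Dirac mass, the cost is `½ ∫ ‖v‖²` plus `γ r₀ / 2 ∫ η²` along the trajectory of
`x₀`. Among the fields with a given value at `x`, the one of minimal norm `minLift V x h` has
norm `√(G_x(h, h))`; so the energy of `v` dominates that of the trajectory for the metric `G`, and
by Jensen's inequality the first term is at least half the squared distance. Jensen's inequality
also bounds the second term, with equality iff `η` is constant along the trajectory; and lifting a
`G`-geodesic minimally to `V` attains both bounds.

An optimal trajectory is a priori only absolutely continuous, and `G` only locally Lipschitz, so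
that the geodesic equation is not available. A curve which realizes the distance between any two of
its points is nevertheless `C¹`: by the parallelogram law, the slopes of its chords over adjacent
intervals of equal length `τ` differ by `O(√τ)`, which is summable over dyadic subdivisions.
-/

open scoped NNReal

noncomputable section

section MinimalLift

/-- `V` is continuously embedded in the bounded Lipschitz fields on `X`: both the sup norm and the
Lipschitz constant of a field are at most `c` times its norm in `V`. -/
structure EmbedsInBoundedLipschitz (V : Type*) {X Y : Type*} [NormedAddCommGroup V]
    [InnerProductSpace ℝ V] [PseudoMetricSpace X] [NormedAddCommGroup Y] [InnerProductSpace ℝ Y]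
    [RKHS ℝ V X Y] (c : ℝ≥0) : Prop where
  norm_apply_le : ∀ (u : V) (x : X), ‖u x‖ ≤ c * ‖u‖
  lipschitzWith : ∀ u : V, LipschitzWith (c * ‖u‖₊) (u : X → Y)

lemma EmbedsInC20.exists_embedsInBoundedLipschitz {n : ℕ} {V : Type*} [NormedAddCommGroup V]
    [InnerProductSpace ℝ V] [RKHS ℝ V (EuclideanSpace ℝ (Fin n)) (EuclideanSpace ℝ (Fin n))]
    (hV : EmbedsInC20 V) : ∃ c : ℝ≥0, EmbedsInBoundedLipschitz V c := by
  obtain ⟨c, hc, hbound⟩ := hV.bound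
  lift c to ℝ≥0 using hc.le
  refine ⟨c, fun u x => by simpa using hbound u 0 (by norm_num) x, fun u => ?_⟩
  refine lipschitzWith_of_nnnorm_fderiv_le ((hV.contDiff u).differentiable (by norm_num))
    fun x => ?_
  simpa [← norm_iteratedFDeriv_one, ← NNReal.coe_le_coe] using hbound u 1 (by norm_num) x

variable {V X Y : Type*} [NormedAddCommGroup V] [InnerProductSpace ℝ V] [CompleteSpace V]
  [NormedAddCommGroup Y] [InnerProductSpace ℝ Y] [CompleteSpace Y]

section Pointwise

variable [RKHS ℝ V X Y] {x : X}

variable (V) in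
/-- The field of minimal norm in `V` among those with value `h` at `x`, if `K_V(x, x)` is
invertible; zero otherwise. -/
def minLift (x : X) : Y →L[ℝ] V :=
  RKHS.kerFun V x ∘L (RKHS.kernel V x x).inverse

lemma minLift_apply_self (hx : (RKHS.kernel V x x).IsInvertible) (h : Y) :
    minLift V x h x = h := by
  simp [minLift, RKHS.kerFun_apply, hx.self_apply_inverse]

lemma inner_minLift (h : Y) (u : V) :
    inner ℝ (minLift V x h) u = inner ℝ ((RKHS.kernel V x x).inverse h) (u x) := by
  rw [minLift, ContinuousLinearMap.comp_apply, RKHS.kerFun_inner]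

lemma norm_minLift_apply_le (hx : (RKHS.kernel V x x).IsInvertible) (u : V) :
    ‖minLift V x (u x)‖ ≤ ‖u‖ := by
  have horth : inner ℝ (minLift V x (u x)) (minLift V x (u x)) = inner ℝ (minLift V x (u x)) u := by
    rw [inner_minLift, inner_minLift, minLift_apply_self hx]
  have hle : ‖minLift V x (u x)‖ * ‖minLift V x (u x)‖ ≤ ‖minLift V x (u x)‖ * ‖u‖ := by
    rw [← real_inner_self_eq_norm_mul_norm, horth]
    exact real_inner_le_norm _ _
  rcases (norm_nonneg (minLift V x (u x))).eq_or_lt with hzero | hpos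
  · exact hzero ▸ norm_nonneg u
  · exact le_of_mul_le_mul_left hle hpos

lemma inner_inverse_kernel_eq_norm_minLift_sq (hx : (RKHS.kernel V x x).IsInvertible) (h : Y) :
    inner ℝ h ((RKHS.kernel V x x).inverse h) = ‖minLift V x h‖ ^ 2 := by
  rw [← real_inner_self_eq_norm_sq, inner_minLift, minLift_apply_self hx, real_inner_comm]

end Pointwise

lemma kernelSpeed_eq_enorm_minLift {n : ℕ}
    [RKHS ℝ V (EuclideanSpace ℝ (Fin n)) (EuclideanSpace ℝ (Fin n))] {x : EuclideanSpace ℝ (Fin n)}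
    (hx : (RKHS.kernel V x x).IsInvertible) (h : EuclideanSpace ℝ (Fin n)) :
    kernelSpeed V x h = ‖minLift V x h‖ₑ := by
  rw [kernelSpeed, kernelMetric, inner_inverse_kernel_eq_norm_minLift_sq hx,
    Real.sqrt_sq (norm_nonneg _), ofReal_norm]

variable [PseudoMetricSpace X] [RKHS ℝ V X Y] {c : ℝ≥0}

lemma EmbedsInBoundedLipschitz.antilipschitzWith_minLift
    (hV : EmbedsInBoundedLipschitz V (X := X) c) {x : X}
    (hx : (RKHS.kernel V x x).IsInvertible) : AntilipschitzWith c (minLift V x) :=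
  (minLift V x).antilipschitz_of_bound fun h => by
    simpa only [minLift_apply_self hx] using hV.norm_apply_le (minLift V x h) x

lemma EmbedsInBoundedLipschitz.lipschitzWith_kerFun (hV : EmbedsInBoundedLipschitz V (X := X) c) :
    LipschitzWith c (fun x : X => RKHS.kerFun V x) := by
  refine LipschitzWith.of_dist_le_mul fun x y => ?_
  rw [dist_eq_norm, ← ContinuousLinearMap.adjoint.norm_map, map_sub]
  refine ContinuousLinearMap.opNorm_le_bound _ (by positivity) fun u => ?_
  simpa [dist_eq_norm, mul_right_comm] using (hV.lipschitzWith u).dist_le_mul x y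

lemma contDiff_adjoint {n : WithTop ℕ∞} :
    ContDiff ℝ n (fun A : Y →L[ℝ] V => ContinuousLinearMap.adjoint A) :=
  IsBoundedLinearMap.contDiff ⟨⟨map_add _, fun r A => by simp⟩, 1, one_pos, fun A => by simp⟩

lemma EmbedsInBoundedLipschitz.locallyLipschitz_minLift
    (hV : EmbedsInBoundedLipschitz V (X := X) c)
    (hK : ∀ x : X, (RKHS.kernel V x x).IsInvertible) :
    LocallyLipschitz (fun x : X => minLift V x) := by
  intro x
  have hsmooth : ContDiffAt ℝ 1 (fun A : Y →L[ℝ] V =>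
      A ∘L (ContinuousLinearMap.adjoint A ∘L A).inverse) (RKHS.kerFun V x) := by
    have hgram : ContDiffAt ℝ 1 (fun A : Y →L[ℝ] V => ContinuousLinearMap.adjoint A ∘L A)
        (RKHS.kerFun V x) := contDiff_adjoint.contDiffAt.clm_comp contDiffAt_id
    refine contDiffAt_id.clm_comp
      (ContDiffAt.fun_comp (g := ContinuousLinearMap.inverse) _ ?_ hgram)
    exact (RKHS.kernel_apply (H := V) x x ▸ hK x).contDiffAt_map_inverse
  obtain ⟨K, t, ht, hlip⟩ := hsmooth.exists_lipschitzOnWith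
  have hker := hV.lipschitzWith_kerFun
  refine ⟨K * c, _, hker.continuous.continuousAt ht, ?_⟩
  simpa only [minLift, RKHS.kernel_apply, Function.comp_def] using
    hlip.comp hker.lipschitzOnWith (mapsTo_preimage _ t)

end MinimalLift

section ContinuousDeriv

variable {E : Type*} [NormedAddCommGroup E] [NormedSpace ℝ E]

/-- `γ` has the continuous derivative `γ'` on the set of times `s`. -/
structure HasContinuousDerivOn (γ γ' : ℝ → E) (s : Set ℝ) : Prop where
  hasDerivWithinAt : ∀ t ∈ s, HasDerivWithinAt γ (γ' t) s t
  continuousOn_deriv : ContinuousOn γ' s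

variable {γ γ' : ℝ → E} {a b s t : ℝ}

lemma HasContinuousDerivOn.continuousOn {s : Set ℝ} (hγ : HasContinuousDerivOn γ γ' s) :
    ContinuousOn γ s :=
  fun t ht => (hγ.hasDerivWithinAt t ht).continuousWithinAt

lemma HasContinuousDerivOn.mono {s t : Set ℝ} (hγ : HasContinuousDerivOn γ γ' t) (hst : s ⊆ t) :
    HasContinuousDerivOn γ γ' s :=
  ⟨fun r hr => (hγ.hasDerivWithinAt r (hst hr)).mono hst, hγ.continuousOn_deriv.mono hst⟩

lemma HasContinuousDerivOn.contDiffOn {s : Set ℝ} (hs : UniqueDiffOn ℝ s)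
    (hγ : HasContinuousDerivOn γ γ' s) : ContDiffOn ℝ 1 γ s :=
  (contDiffOn_one_iff_derivWithin hs).2
    ⟨fun t ht => (hγ.hasDerivWithinAt t ht).differentiableWithinAt,
      hγ.continuousOn_deriv.congr fun t ht => (hγ.hasDerivWithinAt t ht).derivWithin (hs t ht)⟩

lemma hasContinuousDerivOn_derivWithin {s : Set ℝ} (hs : UniqueDiffOn ℝ s)
    (hγ : ContDiffOn ℝ 1 γ s) : HasContinuousDerivOn γ (derivWithin γ s) s :=
  have hγ := (contDiffOn_one_iff_derivWithin hs).1 hγ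
  ⟨fun t ht => (hγ.1 t ht).hasDerivWithinAt, hγ.2⟩

lemma hasContinuousDerivOn_segment (y z : E) (s : Set ℝ) :
    HasContinuousDerivOn (fun t : ℝ => y + t • (z - y)) (fun _ => z - y) s :=
  ⟨fun t _ => by simpa using (((hasDerivAt_id t).smul_const (z - y)).const_add y).hasDerivWithinAt,
    continuousOn_const⟩

lemma HasContinuousDerivOn.integral_eq_sub [CompleteSpace E] (hab : a ≤ b)
    (hγ : HasContinuousDerivOn γ γ' (Icc a b)) : ∫ t in a..b, γ' t = γ b - γ a :=
  intervalIntegral.integral_eq_sub_of_hasDerivAt_of_le hab hγ.continuousOn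
    (fun t ht => (hγ.hasDerivWithinAt t (Ioo_subset_Icc_self ht)).hasDerivAt
      (Icc_mem_nhds ht.1 ht.2))
    (hγ.continuousOn_deriv.intervalIntegrable_of_Icc hab)

end ContinuousDeriv

lemma le_apply_of_forall_gt {f : ℝ → ℝ} (hf : Continuous f) {a b : ℝ}
    (h : ∀ r, a < r → b ≤ f r) : b ≤ f a :=
  ge_of_tendsto (hf.continuousWithinAt (s := Ioi a)) (eventually_nhdsWithin_of_forall h)

section Coframe

variable {E H : Type*} [NormedAddCommGroup E] [NormedSpace ℝ E] [NormedAddCommGroup H]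
  [NormedSpace ℝ H]

/-- The norm `h ↦ ‖L x h‖` on the tangent space at `x`, for a field `L` of linear maps on `E`. -/
@[reducible] def coframeENorm (L : E → E →L[ℝ] H) (x : E) : ENorm (TangentSpace 𝓘(ℝ, E) x) :=
  ⟨fun h => ‖L x h‖ₑ⟩

/-- The infimum of the lengths `∫ ‖L (γ t) (γ' t)‖ dt` of the `C¹` paths `γ` from `x` to `y`. -/
def coframeEDist (L : E → E →L[ℝ] H) (x y : E) : ℝ≥0∞ :=
  letI := coframeENorm L
  Manifold.riemannianEDist 𝓘(ℝ, E) x y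

/-- The distance `coframeEDist` as a real number; it is finite when `L` is continuous. -/
def coframeDist (L : E → E →L[ℝ] H) (x y : E) : ℝ :=
  (coframeEDist L x y).toReal

lemma kernelEDist_eq_coframeEDist {n : ℕ} {V : Type*} [NormedAddCommGroup V]
    [InnerProductSpace ℝ V] [CompleteSpace V]
    [RKHS ℝ V (EuclideanSpace ℝ (Fin n)) (EuclideanSpace ℝ (Fin n))]
    (hK : ∀ x : EuclideanSpace ℝ (Fin n), (RKHS.kernel V x x).IsInvertible) :
    kernelEDist V = coframeEDist (minLift V) := by
  have hspeed : kernelSpeed V = fun x h => ‖minLift V x h‖ₑ :=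
    funext₂ fun x h => kernelSpeed_eq_enorm_minLift (hK x) h
  unfold kernelEDist coframeEDist coframeENorm
  rw [hspeed]
  rfl

variable {L : E → E →L[ℝ] H} {x y z : E}

instance enormSMulClass_coframeENorm :
    letI := coframeENorm L x
    ENormSMulClass ℝ (TangentSpace 𝓘(ℝ, E) x) :=
  letI := coframeENorm L x
  ⟨fun r h => (congrArg (‖·‖ₑ) ((L x).map_smul r h)).trans (enorm_smul r (L x h))⟩

lemma coframeEDist_self : coframeEDist L x x = 0 :=
  letI := coframeENorm L
  Manifold.riemannianEDist_self

lemma coframeEDist_comm : coframeEDist L x y = coframeEDist L y x :=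
  letI := coframeENorm L
  Manifold.riemannianEDist_comm

lemma coframeEDist_triangle : coframeEDist L x z ≤ coframeEDist L x y + coframeEDist L y z :=
  letI := coframeENorm L
  Manifold.riemannianEDist_triangle

lemma HasContinuousDerivOn.continuousOn_norm_coframe (hL : Continuous L) {γ γ' : ℝ → E} {s : Set ℝ}
    (hγ : HasContinuousDerivOn γ γ' s) : ContinuousOn (fun t => ‖L (γ t) (γ' t)‖) s :=
  ((hL.comp_continuousOn hγ.continuousOn).clm_apply hγ.continuousOn_deriv).norm

lemma pathELength_coframeENorm (hL : Continuous L) {γ γ' : ℝ → E} {a b : ℝ} (hab : a < b)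
    (hγ : HasContinuousDerivOn γ γ' (Icc a b)) :
    letI := coframeENorm L
    Manifold.pathELength 𝓘(ℝ, E) γ a b = ENNReal.ofReal (∫ t in a..b, ‖L (γ t) (γ' t)‖) := by
  have hcont : ContinuousOn (fun t => L (γ t) (γ' t)) (Icc a b) :=
    (hL.comp_continuousOn hγ.continuousOn).clm_apply hγ.continuousOn_deriv
  let := coframeENorm L
  rw [Manifold.pathELength_eq_lintegral_mfderivWithin_Icc,
    intervalIntegral.integral_of_le hab.le, ← integral_Icc_eq_integral_Ioc,
    ofReal_integral_norm_eq_lintegral_enorm hcont.integrableOn_Icc]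
  refine setLIntegral_congr_fun measurableSet_Icc fun t ht => ?_
  have hderiv : mfderivWithin 𝓘(ℝ, ℝ) 𝓘(ℝ, E) γ (Icc a b) t (1 : ℝ) = γ' t := by
    rw [mfderivWithin_eq_fderivWithin, ← (hγ.hasDerivWithinAt t ht).derivWithin
      (uniqueDiffOn_Icc hab t ht), ← fderivWithin_derivWithin]
    rfl
  exact congrArg (fun h => ‖L (γ t) h‖ₑ) hderiv

lemma coframeEDist_le_integral (hL : Continuous L) {γ γ' : ℝ → E} {a b : ℝ} (hab : a ≤ b)
    (hγ : HasContinuousDerivOn γ γ' (Icc a b)) :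
    coframeEDist L (γ a) (γ b) ≤ ENNReal.ofReal (∫ t in a..b, ‖L (γ t) (γ' t)‖) := by
  rcases hab.eq_or_lt with rfl | hlt
  · simp [coframeEDist_self]
  let := coframeENorm L
  rw [← pathELength_coframeENorm hL hlt hγ]
  exact Manifold.riemannianEDist_le_pathELength
    (contMDiffOn_iff_contDiffOn.2 (hγ.contDiffOn (uniqueDiffOn_Icc hlt))) rfl rfl hab

lemma coframeEDist_ne_top (hL : Continuous L) : coframeEDist L x y ≠ ∞ := by
  have hsegment := coframeEDist_le_integral hL zero_le_one (hasContinuousDerivOn_segment x y _)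
  rw [zero_smul, add_zero, one_smul, add_sub_cancel] at hsegment
  exact ne_top_of_le_ne_top ENNReal.ofReal_ne_top hsegment

lemma ofReal_coframeDist (hL : Continuous L) :
    ENNReal.ofReal (coframeDist L x y) = coframeEDist L x y :=
  ENNReal.ofReal_toReal (coframeEDist_ne_top hL)

lemma coframeDist_nonneg : 0 ≤ coframeDist L x y := ENNReal.toReal_nonneg

lemma coframeDist_self : coframeDist L x x = 0 := by
  rw [coframeDist, coframeEDist_self, ENNReal.toReal_zero]

lemma coframeDist_comm : coframeDist L x y = coframeDist L y x := by
  rw [coframeDist, coframeEDist_comm, coframeDist]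

lemma coframeDist_triangle (hL : Continuous L) :
    coframeDist L x z ≤ coframeDist L x y + coframeDist L y z :=
  ENNReal.toReal_le_add coframeEDist_triangle (coframeEDist_ne_top hL) (coframeEDist_ne_top hL)

lemma coframeDist_le_integral (hL : Continuous L) {γ γ' : ℝ → E} {a b : ℝ} (hab : a ≤ b)
    (hγ : HasContinuousDerivOn γ γ' (Icc a b)) :
    coframeDist L (γ a) (γ b) ≤ ∫ t in a..b, ‖L (γ t) (γ' t)‖ :=
  ENNReal.toReal_le_of_le_ofReal
    (intervalIntegral.integral_nonneg hab fun _ _ => norm_nonneg _)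
    (coframeEDist_le_integral hL hab hγ)

lemma exists_path_of_coframeDist_lt (hL : Continuous L) {r : ℝ} (hr : coframeDist L x y < r) :
    ∃ γ γ' : ℝ → E, HasContinuousDerivOn γ γ' (Icc 0 1) ∧ γ 0 = x ∧ γ 1 = y ∧
      ∫ t in (0 : ℝ)..1, ‖L (γ t) (γ' t)‖ < r := by
  let := coframeENorm L
  have hr' : coframeEDist L x y < ENNReal.ofReal r :=
    (ENNReal.lt_ofReal_iff_toReal_lt (coframeEDist_ne_top hL)).2 hr
  obtain ⟨γ, h0, h1, hγ, hlt⟩ := Manifold.exists_lt_of_riemannianEDist_lt hr'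
  have hderiv := hasContinuousDerivOn_derivWithin (uniqueDiffOn_Icc one_pos)
    (contMDiffOn_iff_contDiffOn.1 hγ)
  rw [pathELength_coframeENorm hL one_pos hderiv] at hlt
  exact ⟨γ, _, hderiv, h0, h1, (ENNReal.ofReal_lt_ofReal_iff'.1 hlt).1⟩

end Coframe

section Distortion

variable {E H : Type*} [NormedAddCommGroup E] [NormedSpace ℝ E] [NormedAddCommGroup H]
  [NormedSpace ℝ H]

/-- Moving the base point of the norm `h ↦ ‖L x h‖` from any `x` to a point `y` of `K` costs at most
the factor `1 + B ‖y - x‖`. -/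
def HasDistortionBoundOn (L : E → E →L[ℝ] H) (K : Set E) (B : ℝ≥0) : Prop :=
  ∀ y ∈ K, ∀ x h : E, ‖L y h‖ ≤ (1 + B * ‖y - x‖) * ‖L x h‖

variable {L : E → E →L[ℝ] H} {K : Set E} {B c : ℝ≥0}

lemma exists_hasDistortionBoundOn [ProperSpace E] (hL : LocallyLipschitz L)
    (hc : ∀ x, AntilipschitzWith c (L x)) (hK : IsCompact K) :
    ∃ B : ℝ≥0, HasDistortionBoundOn L K B := by
  have hanti (x h : E) : ‖h‖ ≤ c * ‖L x h‖ := (L x).bound_of_antilipschitz (hc x) h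
  obtain ⟨A, hA⟩ := hL.locallyLipschitzOn.exists_lipschitzOnWith_of_compact
    (hK.cthickening (r := 1))
  obtain ⟨M, hM⟩ := hK.exists_bound_of_continuousOn hL.continuous.continuousOn
  let C := max A M.toNNReal
  refine ⟨C * c, fun y hy x h => ?_⟩
  have hC : ‖L y h‖ ≤ ‖L x h‖ + C * ‖y - x‖ * ‖h‖ := by
    rcases le_total (dist x y) 1 with hnear | hfar
    · have hdiff : ‖L y - L x‖ ≤ C * ‖y - x‖ :=
        (hA.weaken (le_max_left A M.toNNReal)).norm_sub_le (Metric.self_subset_cthickening K hy)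
          (Metric.mem_cthickening_of_dist_le x y 1 K hy hnear)
      calc ‖L y h‖ = ‖L x h + (L y - L x) h‖ := by rw [sub_apply, add_sub_cancel]
        _ ≤ _ := norm_add_le_of_le le_rfl ((L y - L x).le_of_opNorm_le hdiff h)
    · rw [dist_comm, dist_eq_norm] at hfar
      have hy : ‖L y‖ ≤ C := (hM y hy).trans
        ((Real.le_coe_toNNReal M).trans (NNReal.coe_le_coe.2 (le_max_right A _)))
      calc ‖L y h‖ ≤ C * 1 * ‖h‖ := by simpa using (L y).le_of_opNorm_le hy h
        _ ≤ C * ‖y - x‖ * ‖h‖ := by gcongr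
        _ ≤ _ := le_add_of_nonneg_left (norm_nonneg _)
  calc ‖L y h‖ ≤ ‖L x h‖ + C * ‖y - x‖ * (c * ‖L x h‖) :=
      hC.trans (by gcongr; exact hanti x h)
    _ = (1 + ↑(C * c) * ‖y - x‖) * ‖L x h‖ := by push_cast; ring

lemma coframeDist_le_one_add_mul_norm (hL : Continuous L) (hB : HasDistortionBoundOn L K B)
    (hK : Convex ℝ K) {y z : E} (hy : y ∈ K) (hz : z ∈ K) :
    coframeDist L y z ≤ (1 + B * ‖z - y‖) * ‖L y (z - y)‖ := by
  have hsegment := hasContinuousDerivOn_segment y z (Icc 0 1)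
  have hlength := coframeDist_le_integral hL zero_le_one hsegment
  rw [zero_smul, add_zero, one_smul, add_sub_cancel] at hlength
  refine hlength.trans ?_
  have hspeed : ∀ t ∈ Icc (0 : ℝ) 1,
      ‖L (y + t • (z - y)) (z - y)‖ ≤ (1 + B * ‖z - y‖) * ‖L y (z - y)‖ := fun t ht => by
    refine (hB _ (hK.add_smul_sub_mem hy hz ht) y _).trans ?_
    gcongr
    rw [add_sub_cancel_left, norm_smul, Real.norm_of_nonneg ht.1]
    exact mul_le_of_le_one_left (norm_nonneg _) ht.2
  simpa using intervalIntegral.integral_mono_on (μ := volume) zero_le_one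
    ((hsegment.continuousOn_norm_coframe hL).intervalIntegrable_of_Icc zero_le_one)
    intervalIntegrable_const hspeed

variable [CompleteSpace E]

lemma HasContinuousDerivOn.norm_sub_le_mul_integral_norm_coframe (hL : Continuous L)
    (hc : ∀ x, AntilipschitzWith c (L x)) {γ γ' : ℝ → E} {a b t : ℝ}
    (hγ : HasContinuousDerivOn γ γ' (Icc a b)) (ht : t ∈ Icc a b) :
    ‖γ t - γ a‖ ≤ c * ∫ t in a..b, ‖L (γ t) (γ' t)‖ := by
  have hspeed := hγ.continuousOn_norm_coframe hL
  have hsub : Icc a t ⊆ Icc a b := Icc_subset_Icc_right ht.2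
  rw [← (hγ.mono hsub).integral_eq_sub ht.1]
  calc ‖∫ r in a..t, γ' r‖ ≤ ∫ r in a..t, c * ‖L (γ r) (γ' r)‖ :=
        intervalIntegral.norm_integral_le_of_norm_le ht.1
          (ae_of_all _ fun r _ => (L (γ r)).bound_of_antilipschitz (hc _) _)
          (((hspeed.mono hsub).intervalIntegrable_of_Icc ht.1).const_mul c)
    _ = c * ∫ r in a..t, ‖L (γ r) (γ' r)‖ := intervalIntegral.integral_const_mul _ _
    _ ≤ _ := by
        gcongr
        exact intervalIntegral.integral_mono_interval le_rfl ht.1 ht.2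
          (ae_of_all _ fun _ => norm_nonneg _)
          (hspeed.intervalIntegrable_of_Icc (ht.1.trans ht.2))

lemma norm_sub_le_mul_coframeDist (hL : Continuous L) (hc : ∀ x, AntilipschitzWith c (L x))
    (x y : E) : ‖x - y‖ ≤ c * coframeDist L x y := by
  refine le_apply_of_forall_gt (f := fun r => c * r) (by fun_prop) fun r hr => ?_
  obtain ⟨γ, γ', hγ, rfl, rfl, hlt⟩ := exists_path_of_coframeDist_lt hL hr
  rw [norm_sub_rev]
  exact (hγ.norm_sub_le_mul_integral_norm_coframe hL hc (right_mem_Icc.2 zero_le_one)).trans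
    (by gcongr)

lemma norm_coframe_sub_le_mul_coframeDist [CompleteSpace H] (hL : Continuous L)
    (hc : ∀ x, AntilipschitzWith c (L x)) (hB : HasDistortionBoundOn L K B) {p : E} (hp : p ∈ K)
    (y z : E) :
    ‖L p (z - y)‖ ≤ (1 + B * (‖p - y‖ + c * coframeDist L y z)) * coframeDist L y z := by
  refine le_apply_of_forall_gt (f := fun r => (1 + B * (‖p - y‖ + c * r)) * r) (by fun_prop)
    fun r hr => ?_
  have hr0 : 0 ≤ r := coframeDist_nonneg.trans hr.le
  obtain ⟨γ, γ', hγ, rfl, rfl, hlt⟩ := exists_path_of_coframeDist_lt hL hr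
  have hspeed : ∀ t ∈ Icc (0 : ℝ) 1,
      ‖L p (γ' t)‖ ≤ (1 + B * (‖p - γ 0‖ + c * r)) * ‖L (γ t) (γ' t)‖ := fun t ht => by
    refine (hB p hp (γ t) _).trans ?_
    gcongr
    refine (norm_sub_le_norm_sub_add_norm_sub p (γ 0) (γ t)).trans ?_
    rw [norm_sub_rev (γ 0)]
    gcongr
    exact (hγ.norm_sub_le_mul_integral_norm_coframe hL hc ht).trans (by gcongr)
  rw [← hγ.integral_eq_sub zero_le_one, ← ContinuousLinearMap.intervalIntegral_comp_comm _
    (hγ.continuousOn_deriv.intervalIntegrable_of_Icc zero_le_one)]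
  calc ‖∫ t in (0 : ℝ)..1, L p (γ' t)‖
      ≤ ∫ t in (0 : ℝ)..1, (1 + B * (‖p - γ 0‖ + c * r)) * ‖L (γ t) (γ' t)‖ :=
        intervalIntegral.norm_integral_le_of_norm_le zero_le_one
          (ae_of_all _ fun t ht => hspeed t (Ioc_subset_Icc_self ht))
          (((hγ.continuousOn_norm_coframe hL).intervalIntegrable_of_Icc zero_le_one).const_mul _)
    _ = (1 + B * (‖p - γ 0‖ + c * r)) * ∫ t in (0 : ℝ)..1, ‖L (γ t) (γ' t)‖ :=
        intervalIntegral.integral_const_mul _ _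
    _ ≤ _ := by gcongr

end Distortion

section AbsolutelyContinuousCurve

variable {E H : Type*} [NormedAddCommGroup E] [NormedSpace ℝ E] [NormedAddCommGroup H]
  [NormedSpace ℝ H] {L : E → E →L[ℝ] H} {K : Set E} {B c : ℝ≥0} {a b : ℝ}

lemma exists_continuous_integral_norm_sub_le {w : ℝ → E}
    (hw : IntervalIntegrable w volume a b) (hab : a ≤ b) {ε : ℝ} (hε : 0 < ε) :
    ∃ g : ℝ → E, Continuous g ∧ ∫ t in a..b, ‖w t - g t‖ ≤ ε := by
  obtain ⟨g, -, hle, hg, -⟩ := hw.1.exists_hasCompactSupport_integral_sub_le hε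
  exact ⟨g, hg, by rwa [intervalIntegral.integral_of_le hab]⟩

lemma hasContinuousDerivOn_primitive [CompleteSpace E] {g : ℝ → E} (hg : Continuous g) (p : E)
    (s : Set ℝ) : HasContinuousDerivOn (fun t => p + ∫ r in a..t, g r) g s :=
  ⟨fun t _ => ((hg.integral_hasStrictDerivAt a t).hasDerivAt.const_add p).hasDerivWithinAt,
    hg.continuousOn⟩

lemma norm_primitive_sub_primitive_le {w g : ℝ → E} (hw : IntervalIntegrable w volume a b)
    (hg : IntervalIntegrable g volume a b) {t : ℝ} (ht : t ∈ Icc a b) :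
    ‖(∫ r in a..t, w r) - ∫ r in a..t, g r‖ ≤ ∫ r in a..b, ‖w r - g r‖ := by
  have hsub : uIcc a t ⊆ uIcc a b := by
    simpa only [uIcc_of_le ht.1, uIcc_of_le (ht.1.trans ht.2)] using Icc_subset_Icc_right ht.2
  rw [← intervalIntegral.integral_sub (hw.mono_set hsub) (hg.mono_set hsub)]
  exact (intervalIntegral.norm_integral_le_integral_norm ht.1).trans
    (intervalIntegral.integral_mono_interval le_rfl ht.1 ht.2
      (ae_of_all _ fun _ => norm_nonneg _) (hw.sub hg).norm)

lemma coframeDist_primitive_le [CompleteSpace E] (hL : Continuous L)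
    (hB : HasDistortionBoundOn L K B) {M : ℝ≥0} (hM : ∀ y ∈ K, ‖L y‖ ≤ M)
    {w g : ℝ → E} {ρ : ℝ → ℝ} {p : E} {ε : ℝ} (hab : a ≤ b) (hw : IntervalIntegrable w volume a b)
    (hρ : IntervalIntegrable ρ volume a b) (hg : Continuous g)
    (hwg : ∫ t in a..b, ‖w t - g t‖ ≤ ε)
    (hK : ∀ t ∈ Icc a b, p + ∫ r in a..t, g r ∈ K)
    (hle : ∀ t ∈ Icc a b, ‖L (p + ∫ r in a..t, w r) (w t)‖ ≤ ρ t) :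
    coframeDist L p (p + ∫ r in a..b, g r) ≤ (1 + B * ε) * ((∫ t in a..b, ρ t) + M * ε) := by
  have hgi := hg.intervalIntegrable (μ := volume) a b
  have hdiff := (hw.sub hgi).norm
  have hε : 0 ≤ ε := (intervalIntegral.integral_nonneg hab fun _ _ => norm_nonneg _).trans hwg
  have hlength := coframeDist_le_integral hL hab (hasContinuousDerivOn_primitive hg p (a := a) _)
  rw [intervalIntegral.integral_same, add_zero] at hlength
  have hspeed : ∀ t ∈ Icc a b, ‖L (p + ∫ r in a..t, g r) (g t)‖ ≤
      (1 + B * ε) * (ρ t + M * ‖w t - g t‖) := fun t ht => by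
    have hclose : ‖(p + ∫ r in a..t, g r) - (p + ∫ r in a..t, w r)‖ ≤ ε := by
      rw [add_sub_add_left_eq_sub, norm_sub_rev]
      exact (norm_primitive_sub_primitive_le hw hgi ht).trans hwg
    calc ‖L (p + ∫ r in a..t, g r) (g t)‖
        = ‖L (p + ∫ r in a..t, g r) (w t) - L (p + ∫ r in a..t, g r) (w t - g t)‖ := by
          rw [← map_sub, sub_sub_cancel]
      _ ≤ (1 + B * ε) * ρ t + M * ‖w t - g t‖ := by
          refine norm_sub_le_of_le ((hB _ (hK t ht) (p + ∫ r in a..t, w r) _).trans ?_)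
            (ContinuousLinearMap.le_of_opNorm_le _ (hM _ (hK t ht)) _)
          gcongr
          exact hle t ht
      _ ≤ (1 + B * ε) * (ρ t + M * ‖w t - g t‖) := by
          have : 0 ≤ B * ε * (M * ‖w t - g t‖) := by positivity
          linarith
  calc _ ≤ _ := hlength
    _ ≤ ∫ t in a..b, (1 + B * ε) * (ρ t + M * ‖w t - g t‖) :=
      intervalIntegral.integral_mono_on hab
        (((hasContinuousDerivOn_primitive hg p _).continuousOn_norm_coframe
          hL).intervalIntegrable_of_Icc hab) ((hρ.add (hdiff.const_mul M)).const_mul _) hspeed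
    _ = (1 + B * ε) * ((∫ t in a..b, ρ t) + M * ∫ t in a..b, ‖w t - g t‖) := by
      rw [intervalIntegral.integral_const_mul,
        intervalIntegral.integral_add hρ (hdiff.const_mul _), intervalIntegral.integral_const_mul]
    _ ≤ _ := by gcongr

/-- The velocity `w` is approximated in `L¹` by continuous ones. -/
theorem coframeDist_le_integral_of_eq_primitive [ProperSpace E] (hL : LocallyLipschitz L)
    (hc : ∀ x, AntilipschitzWith c (L x)) {w : ℝ → E} {ρ : ℝ → ℝ} {p : E} (hab : a ≤ b)
    (hw : IntervalIntegrable w volume a b) (hρ : IntervalIntegrable ρ volume a b)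
    (hle : ∀ t ∈ Icc a b, ‖L (p + ∫ r in a..t, w r) (w t)‖ ≤ ρ t) :
    coframeDist L p (p + ∫ r in a..b, w r) ≤ ∫ t in a..b, ρ t := by
  have hx : ContinuousOn (fun t => p + ∫ r in a..t, w r) (Icc a b) := by
    simpa only [uIcc_of_le hab] using
      (intervalIntegral.continuousOn_primitive_interval' hw left_mem_uIcc).const_add p
  obtain ⟨R, hR⟩ := isCompact_Icc.exists_bound_of_continuousOn hx
  let K : Set E := Metric.closedBall 0 (R + 1)
  obtain ⟨B, hB⟩ := exists_hasDistortionBoundOn hL hc (isCompact_closedBall (0 : E) (R + 1))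
  obtain ⟨M, hM⟩ := (isCompact_closedBall (0 : E) (R + 1)).exists_bound_of_continuousOn
    hL.continuous.continuousOn
  have hM' : ∀ y ∈ K, ‖L y‖ ≤ M.toNNReal := fun y hy => (hM y hy).trans (Real.le_coe_toNNReal M)
  suffices happrox : ∀ ε : ℝ, 0 < ε → coframeDist L p (p + ∫ r in a..b, w r) ≤
      (1 + B * ε) * ((∫ t in a..b, ρ t) + M.toNNReal * ε) + (1 + B * ε) * (M.toNNReal * ε) by
    simpa using le_apply_of_forall_gt (f := fun ε => (1 + B * ε) * ((∫ t in a..b, ρ t) +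
      M.toNNReal * ε) + (1 + B * ε) * (M.toNNReal * ε)) (by fun_prop) happrox
  intro ε hε
  obtain ⟨g, hg, hwg⟩ := exists_continuous_integral_norm_sub_le hw hab (lt_min hε one_pos)
  have hgi := hg.intervalIntegrable (μ := volume) a b
  have hclose (t : ℝ) (ht : t ∈ Icc a b) :
      ‖(p + ∫ r in a..t, w r) - (p + ∫ r in a..t, g r)‖ ≤ min ε 1 := by
    rw [add_sub_add_left_eq_sub]
    exact (norm_primitive_sub_primitive_le hw hgi ht).trans hwg
  have hwK (t : ℝ) (ht : t ∈ Icc a b) : p + ∫ r in a..t, w r ∈ K :=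
    mem_closedBall_zero_iff.2 ((hR t ht).trans (by simp))
  have hgK (t : ℝ) (ht : t ∈ Icc a b) : p + ∫ r in a..t, g r ∈ K := by
    rw [mem_closedBall_zero_iff]
    exact (norm_le_norm_add_norm_sub _ _).trans
      (add_le_add (hR t ht) ((hclose t ht).trans (min_le_right _ _)))
  have hb : b ∈ Icc a b := right_mem_Icc.2 hab
  have hend := (hclose b hb).trans (min_le_left _ _)
  refine (coframeDist_triangle hL.continuous).trans (add_le_add
    (coframeDist_primitive_le hL.continuous hB hM' hab hw hρ hg (hwg.trans (min_le_left _ _)) hgK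
      hle) ?_)
  calc _ ≤ _ := coframeDist_le_one_add_mul_norm hL.continuous hB (convex_closedBall _ _)
        (hgK b hb) (hwK b hb)
    _ ≤ _ := by
      gcongr
      exact (ContinuousLinearMap.le_of_opNorm_le _ (hM' _ (hgK b hb)) _).trans (by gcongr)

end AbsolutelyContinuousCurve

section ChordDeviation

variable {E : Type*} [NormedAddCommGroup E] [NormedSpace ℝ E] {x : ℝ → E} {C : ℝ≥0}
  {a b m t : ℝ} {s : Set ℝ}

lemma exists_hasContinuousDerivOn_of_cauchy_slope [CompleteSpace E]
    (hx : ∀ t ∈ s, Cauchy (map (fun p : ℝ × ℝ => slope x p.1 p.2) (𝓝[s.offDiag] (t, t)))) :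
    ∃ g, HasContinuousDerivOn x g s := by
  let S : ℝ × ℝ → E := fun p => slope x p.1 p.2
  have hlim (t : ℝ) (ht : t ∈ s) : ∃ y, Tendsto S (𝓝[s.offDiag] (t, t)) (𝓝 y) :=
    have := (hx t ht).1.of_map
    cauchy_map_iff_exists_tendsto.1 (hx t ht)
  refine ⟨fun t => extendFrom s.offDiag S (t, t), ⟨fun t ht => ?_, ?_⟩⟩
  · rw [hasDerivWithinAt_iff_tendsto_slope]
    refine (tendsto_extendFrom (hlim t ht)).comp (f := fun r => (t, r))
      (tendsto_nhdsWithin_iff.2 ⟨?_, ?_⟩)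
    · exact ((Continuous.prodMk_right t).tendsto t).mono_left nhdsWithin_le_nhds
    · filter_upwards [self_mem_nhdsWithin] with r hr
      exact ⟨ht, hr.1, Ne.symm hr.2⟩
  · have hdiag : (fun t : ℝ => (t, t)) '' s ⊆ closure s.offDiag := by
      rintro _ ⟨t, ht, rfl⟩
      exact mem_closure_iff_nhdsWithin_neBot.2 (hx t ht).1.of_map
    refine (continuousOn_extendFrom hdiag ?_).comp (by fun_prop) (mapsTo_image _ s)
    rintro _ ⟨t, ht, rfl⟩
    exact hlim t ht

/-- The deviation of the curve `x` from its chords over intervals of length `τ` with end points in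
`s` is at most `C τ ^ (3 / 2)`. Multiplying by `τ` makes the deviation at `m` from the chord over
`[a, b]` the difference in this definition. -/
def HasChordDeviationBoundOn (x : ℝ → E) (C : ℝ≥0) (s : Set ℝ) : Prop :=
  ∀ ⦃a m b : ℝ⦄, a ∈ s → b ∈ s → a ≤ m → m ≤ b →
    ‖(b - m) • (x m - x a) - (m - a) • (x b - x m)‖ ≤ C * ((b - a) ^ 2 * √(b - a))

namespace HasChordDeviationBoundOn

lemma mono {t : Set ℝ} (hx : HasChordDeviationBoundOn x C t) (hst : s ⊆ t) :
    HasChordDeviationBoundOn x C s :=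
  fun _ _ _ ha hb => hx (hst ha) (hst hb)

lemma comp_neg (hx : HasChordDeviationBoundOn x C s) :
    HasChordDeviationBoundOn (fun t => x (-t)) C (-s) := by
  intro a m b ha hb ham hmb
  have h := hx (m := -m) hb ha (neg_le_neg hmb) (neg_le_neg ham)
  rw [neg_sub_neg, neg_sub_neg, neg_sub_neg] at h
  convert h using 2
  module

lemma norm_slope_sub_slope_le_of_sub_le_two_mul (hx : HasChordDeviationBoundOn x C (Icc a b))
    (ham : a < m) (hmb : m ≤ b) (h2 : b - a ≤ 2 * (m - a)) :
    ‖slope x a m - slope x a b‖ ≤ 2 * C * √(b - a) := by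
  have hm : 0 < m - a := sub_pos.2 ham
  have hb : 0 < b - a := sub_pos.2 (ham.trans_le hmb)
  have hslope : slope x a m - slope x a b =
      ((m - a) * (b - a))⁻¹ • ((b - m) • (x m - x a) - (m - a) • (x b - x m)) := by
    rw [eq_inv_smul_iff₀ (by positivity), smul_sub, slope_def_module, slope_def_module, smul_smul,
      smul_smul, mul_right_comm, mul_inv_cancel₀ hm.ne', mul_assoc, mul_inv_cancel₀ hb.ne']
    module
  rw [hslope, norm_smul, norm_inv, Real.norm_of_nonneg (by positivity),
    inv_mul_le_iff₀ (by positivity)]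
  refine (hx (left_mem_Icc.2 (by linarith)) (right_mem_Icc.2 (by linarith)) ham.le hmb).trans ?_
  calc C * ((b - a) ^ 2 * √(b - a)) = (b - a) * (b - a) * (C * √(b - a)) := by ring
    _ ≤ 2 * (m - a) * (b - a) * (C * √(b - a)) := by gcongr
    _ = _ := by ring

/-- Halving the interval until `m` lies in its right half costs a geometric series, as
`2 + 8 / √2 ≤ 8`. -/
lemma norm_slope_left_sub_slope_le (hx : HasChordDeviationBoundOn x C (Icc a b)) (ham : a < m)
    (hmb : m ≤ b) : ‖slope x a m - slope x a b‖ ≤ 8 * C * √(b - a) := by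
  obtain ⟨k, hk⟩ := pow_unbounded_of_one_lt ((b - a) / (m - a)) (one_lt_two (α := ℝ))
  replace hk := ((div_lt_iff₀ (sub_pos.2 ham)).1 hk).le
  induction k generalizing b with
  | zero =>
    obtain rfl : m = b := le_antisymm hmb (by simpa using hk)
    rw [sub_self, norm_zero]
    positivity
  | succ k ih =>
    rcases le_or_gt (b - a) (2 * (m - a)) with hright | hleft
    · refine (hx.norm_slope_sub_slope_le_of_sub_le_two_mul ham hmb hright).trans ?_
      gcongr
      norm_num
    have hnear := ih (b := (a + b) / 2) (hx.mono (Icc_subset_Icc_right (by linarith)))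
      (by linarith) (by rw [pow_succ] at hk; linarith)
    have hhalf := hx.norm_slope_sub_slope_le_of_sub_le_two_mul (m := (a + b) / 2)
      (by linarith) (by linarith) (by linarith)
    have hsqrt : √((a + b) / 2 - a) ≤ 3 / 4 * √(b - a) := by
      rw [Real.sqrt_le_left (by positivity), mul_pow, Real.sq_sqrt (by linarith)]
      linarith
    calc _ ≤ _ := norm_sub_le_norm_sub_add_norm_sub _ (slope x a ((a + b) / 2)) _
      _ ≤ 8 * C * (3 / 4 * √(b - a)) + 2 * C * √(b - a) :=
        add_le_add (hnear.trans (by gcongr)) hhalf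
      _ = _ := by ring

lemma norm_slope_right_sub_slope_le (hx : HasChordDeviationBoundOn x C (Icc a b)) (ham : a ≤ m)
    (hmb : m < b) : ‖slope x m b - slope x a b‖ ≤ 8 * C * √(b - a) := by
  have hslope (r : ℝ) : slope (fun t => x (-t)) (-b) (-r) = -slope x r b := by
    rw [slope_comm, slope_def_module, slope_def_module, neg_neg, neg_neg, neg_sub_neg, ← neg_smul,
      ← inv_neg, neg_sub]
  have hreflect : HasChordDeviationBoundOn (fun t => x (-t)) C (Icc (-b) (-a)) := by
    simpa using hx.comp_neg
  have h := hreflect.norm_slope_left_sub_slope_le (neg_lt_neg hmb) (neg_le_neg ham)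
  rwa [hslope, hslope, neg_sub_neg, norm_sub_rev, neg_sub_neg] at h

lemma norm_slope_sub_slope_le (hx : HasChordDeviationBoundOn x C (Icc a b)) {p : ℝ × ℝ}
    (hp : p ∈ (Icc a b).offDiag) : ‖slope x p.1 p.2 - slope x a b‖ ≤ 16 * C * √(b - a) := by
  obtain ⟨s, t⟩ := p
  obtain ⟨hs, ht, hne⟩ := hp
  wlog hst : s < t generalizing s t
  · rw [slope_comm]
    exact this t s ht hs hne.symm (hne.lt_or_gt.resolve_left hst)
  have hleft := hx.norm_slope_left_sub_slope_le (hs.1.trans_lt hst) ht.2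
  have hright := (hx.mono (Icc_subset_Icc_right ht.2)).norm_slope_right_sub_slope_le hs.1 hst
  calc _ ≤ _ := norm_sub_le_norm_sub_add_norm_sub _ (slope x a t) _
    _ ≤ 8 * C * √(b - a) + 8 * C * √(b - a) :=
      add_le_add (hright.trans (by gcongr; exact ht.2)) hleft
    _ = _ := by ring

lemma cauchy_slope (hx : HasChordDeviationBoundOn x C (Icc a b)) (hab : a < b)
    (ht : t ∈ Icc a b) :
    Cauchy (map (fun p : ℝ × ℝ => slope x p.1 p.2) (𝓝[(Icc a b).offDiag] (t, t))) := by
  have : (𝓝[(Icc a b).offDiag] (t, t)).NeBot := by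
    have hacc : (𝓝[Icc a b \ {t}] t).NeBot := accPt_principal_iff_nhdsWithin.1
      ((uniqueDiffOn_Icc hab).uniqueDiffWithinAt ht).accPt
    refine Tendsto.neBot (f := fun r => (t, r)) (x := 𝓝[Icc a b \ {t}] t)
      (tendsto_nhdsWithin_iff.2 ⟨?_, ?_⟩)
    · exact ((Continuous.prodMk_right t).tendsto t).mono_left nhdsWithin_le_nhds
    · filter_upwards [self_mem_nhdsWithin] with r hr
      exact ⟨ht, hr.1, Ne.symm hr.2⟩
  refine Metric.cauchy_iff.2 ⟨inferInstance, fun ε hε => ?_⟩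
  have hmodulus : Tendsto (fun δ : ℝ => 2 * (16 * C * √(2 * δ))) (𝓝[>] 0) (𝓝 0) :=
    tendsto_nhdsWithin_of_tendsto_nhds (Continuous.tendsto' (by fun_prop) _ _ (by simp))
  obtain ⟨δ, hδε, hδ⟩ := ((hmodulus.eventually (gt_mem_nhds hε)).and self_mem_nhdsWithin).exists
  have hnear {p : ℝ × ℝ} (hp : p ∈ (Icc a b).offDiag ∩ Metric.ball (t, t) δ) :
      ‖slope x p.1 p.2 - slope x (max a (t - δ)) (min b (t + δ))‖ ≤ 16 * C * √(2 * δ) := by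
    obtain ⟨⟨h1, h2, hne⟩, hball⟩ := hp
    simp only [Metric.mem_ball, Prod.dist_eq, max_lt_iff, Real.dist_eq, abs_lt] at hball
    refine ((hx.mono (Icc_subset_Icc (le_max_left a (t - δ))
      (min_le_left b (t + δ)))).norm_slope_sub_slope_le ⟨?_, ?_, hne⟩).trans ?_
    · exact ⟨max_le h1.1 (by linarith), le_min h1.2 (by linarith)⟩
    · exact ⟨max_le h2.1 (by linarith), le_min h2.2 (by linarith)⟩
    · gcongr
      linarith [le_max_right a (t - δ), min_le_right b (t + δ)]
  refine ⟨_, image_mem_map (inter_mem self_mem_nhdsWithin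
    (mem_nhdsWithin_of_mem_nhds (Metric.ball_mem_nhds (t, t) hδ))), ?_⟩
  rintro _ ⟨p, hp, rfl⟩ _ ⟨q, hq, rfl⟩
  have htriangle := norm_sub_le_norm_sub_add_norm_sub (slope x p.1 p.2)
    (slope x (max a (t - δ)) (min b (t + δ))) (slope x q.1 q.2)
  rw [norm_sub_rev (slope x (max a (t - δ)) (min b (t + δ)))] at htriangle
  rw [dist_eq_norm]
  linarith [hnear hp, hnear hq]

theorem exists_hasContinuousDerivOn [CompleteSpace E]
    (hx : HasChordDeviationBoundOn x C (Icc a b)) (hab : a < b) :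
    ∃ g, HasContinuousDerivOn x g (Icc a b) :=
  exists_hasContinuousDerivOn_of_cauchy_slope fun _ => hx.cauchy_slope hab

end HasChordDeviationBoundOn

end ChordDeviation

section ProportionalCurve

lemma norm_smul_sub_smul_sq {H : Type*} [NormedAddCommGroup H] [InnerProductSpace ℝ H] (α β : ℝ)
    (u w : H) : ‖β • u - α • w‖ ^ 2 =
      β * (α + β) * ‖u‖ ^ 2 + α * (α + β) * ‖w‖ ^ 2 - α * β * ‖u + w‖ ^ 2 := by
  rw [norm_sub_sq_real, norm_add_sq_real, norm_smul, norm_smul, real_inner_smul_left,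
    real_inner_smul_right, mul_pow, mul_pow, Real.norm_eq_abs, Real.norm_eq_abs, sq_abs, sq_abs]
  ring

/-- Strict convexity of the norm in a quantitative form. -/
lemma norm_smul_sub_smul_sq_le {H : Type*} [NormedAddCommGroup H] [InnerProductSpace ℝ H]
    {u w : H} {α β D X : ℝ} (hα : 0 ≤ α) (hβ : 0 ≤ β) (hD : 0 ≤ D) (hX : 1 ≤ X)
    (hu : ‖u‖ ≤ X * (D * α)) (hw : ‖w‖ ≤ X * (D * β)) (huw : D * (α + β) ≤ X * ‖u + w‖) :
    ‖β • u - α • w‖ ^ 2 ≤ (X ^ 4 - 1) * D ^ 2 * (α + β) ^ 4 := by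
  have hX4 : 0 ≤ X ^ 4 - 1 := sub_nonneg.2 (one_le_pow₀ hX)
  calc ‖β • u - α • w‖ ^ 2 ≤ X ^ 2 * ‖β • u - α • w‖ ^ 2 :=
        le_mul_of_one_le_left (sq_nonneg _) (one_le_pow₀ hX)
    _ = X ^ 2 * (β * (α + β) * ‖u‖ ^ 2 + α * (α + β) * ‖w‖ ^ 2) -
        α * β * (X * ‖u + w‖) ^ 2 := by rw [norm_smul_sub_smul_sq]; ring
    _ ≤ X ^ 2 * (β * (α + β) * (X * (D * α)) ^ 2 + α * (α + β) * (X * (D * β)) ^ 2) -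
        α * β * (D * (α + β)) ^ 2 := by gcongr
    _ = (X ^ 4 - 1) * D ^ 2 * ((α + β) ^ 2 * (α * β)) := by ring
    _ ≤ (X ^ 4 - 1) * D ^ 2 * ((α + β) ^ 2 * (α + β) ^ 2) := by
        gcongr
        nlinarith
    _ = _ := by ring

lemma one_add_mul_pow_le {K t : ℝ} (hK : 0 ≤ 1 + K) (ht : t ∈ Icc (0 : ℝ) 1) (n : ℕ) :
    (1 + K * t) ^ n - 1 ≤ ((1 + K) ^ n - 1) * t := by
  have h := (convexOn_pow n).2 (mem_Ici.2 zero_le_one) (mem_Ici.2 hK) (sub_nonneg.2 ht.2) ht.1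
    (sub_add_cancel 1 t)
  simp only [smul_eq_mul, one_pow] at h
  rw [show 1 + K * t = (1 - t) * 1 + t * (1 + K) by ring]
  linarith

/-- The chord of the curve `x` between the times `a` and `b` in `s` has length `D |b - a|`, up to a
factor `1 + O(K τ)`, for the norm `h ↦ ‖L (x p) h‖` at a time `p`, if `a`, `b` and `p` lie in an
interval of length `τ`. -/
structure HasChordSpeedOn {E H : Type*} [NormedAddCommGroup E] [NormedSpace ℝ E]
    [NormedAddCommGroup H] [NormedSpace ℝ H] (L : E → E →L[ℝ] H) (x : ℝ → E) (D K : ℝ)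
    (s : Set ℝ) : Prop where
  le_mul_norm : ∀ a ∈ s, ∀ b ∈ s, D * |b - a| ≤ (1 + K * |b - a|) * ‖L (x a) (x b - x a)‖
  norm_le_mul : ∀ p ∈ s, ∀ a ∈ s, ∀ b ∈ s,
    ‖L (x p) (x b - x a)‖ ≤ (1 + K * (|p - a| + |b - a|)) * (D * |b - a|)

variable {E H : Type*} [NormedAddCommGroup E] [NormedSpace ℝ E] [NormedAddCommGroup H]
  {c : ℝ≥0} {x : ℝ → E} {D K : ℝ}

lemma exists_hasChordSpeedOn [ProperSpace E] [NormedSpace ℝ H] [CompleteSpace H]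
    {L : E → E →L[ℝ] H} (hL : LocallyLipschitz L) (hc : ∀ x, AntilipschitzWith c (L x))
    (hD : 0 ≤ D)
    (hx : ∀ s ∈ Icc (0 : ℝ) 1, ∀ t ∈ Icc (0 : ℝ) 1, coframeDist L (x s) (x t) = D * |t - s|) :
    ∃ K : ℝ, 0 ≤ K ∧ HasChordSpeedOn L x D K (Icc 0 1) := by
  have hdist (s : ℝ) (hs : s ∈ Icc (0 : ℝ) 1) (t : ℝ) (ht : t ∈ Icc (0 : ℝ) 1) :
      ‖x t - x s‖ ≤ c * (D * |t - s|) := by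
    rw [← hx s hs t ht, norm_sub_rev]
    exact norm_sub_le_mul_coframeDist hL.continuous hc _ _
  have hball (s : ℝ) (hs : s ∈ Icc (0 : ℝ) 1) : x s ∈ Metric.closedBall (x 0) (c * D) := by
    rw [mem_closedBall_iff_norm]
    refine (hdist 0 (left_mem_Icc.2 zero_le_one) s hs).trans ?_
    rw [sub_zero, abs_of_nonneg hs.1]
    gcongr
    exact mul_le_of_le_one_right hD hs.2
  obtain ⟨B, hB⟩ := exists_hasDistortionBoundOn hL hc (isCompact_closedBall (x 0) (c * D))
  refine ⟨B * (c * D), by positivity, fun s hs t ht => ?_, fun p hp s hs t ht => ?_⟩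
  · rw [← hx s hs t ht]
    refine (coframeDist_le_one_add_mul_norm hL.continuous hB (convex_closedBall _ _)
      (hball s hs) (hball t ht)).trans ?_
    rw [mul_assoc (B : ℝ), mul_assoc (c : ℝ)]
    gcongr
    exact hdist s hs t ht
  · have hle := norm_coframe_sub_le_mul_coframeDist hL.continuous hc hB (hball p hp) (x s) (x t)
    rw [hx s hs t ht] at hle
    refine hle.trans ?_
    rw [mul_assoc (B : ℝ), mul_add (c * D), mul_assoc (c : ℝ), mul_assoc (c : ℝ)]
    gcongr
    exact hdist s hs p hp

variable [InnerProductSpace ℝ H] {L : E → E →L[ℝ] H}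

lemma HasChordSpeedOn.norm_coframe_chord_deviation_le (hx : HasChordSpeedOn L x D K (Icc 0 1))
    (hD : 0 ≤ D) (hK : 0 ≤ K) {a m b : ℝ} (ha : a ∈ Icc (0 : ℝ) 1) (hb : b ∈ Icc (0 : ℝ) 1)
    (ham : a ≤ m) (hmb : m ≤ b) :
    ‖L (x a) ((b - m) • (x m - x a) - (m - a) • (x b - x m))‖ ≤
      √((1 + K) ^ 4 - 1) * D * ((b - a) ^ 2 * √(b - a)) := by
  have hm : m ∈ Icc (0 : ℝ) 1 := ⟨ha.1.trans ham, hmb.trans hb.2⟩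
  have hK4 : 0 ≤ (1 + K) ^ 4 - 1 := sub_nonneg.2 (one_le_pow₀ (by linarith))
  have hα : 0 ≤ m - a := sub_nonneg.2 ham
  have hβ : 0 ≤ b - m := sub_nonneg.2 hmb
  have hτ : 0 ≤ b - a := sub_nonneg.2 (ham.trans hmb)
  let u := L (x a) (x m - x a)
  let w := L (x a) (x b - x m)
  have hu : ‖u‖ ≤ (1 + K * (b - a)) * (D * (m - a)) := by
    refine (hx.norm_le_mul a ha a ha m hm).trans ?_
    rw [sub_self, abs_zero, zero_add, abs_of_nonneg hα]
    gcongr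
  have hw : ‖w‖ ≤ (1 + K * (b - a)) * (D * (b - m)) := by
    refine (hx.norm_le_mul a ha m hm b hb).trans_eq ?_
    rw [abs_sub_comm, abs_of_nonneg hα, abs_of_nonneg hβ, add_comm (m - a), sub_add_sub_cancel]
  have huw : D * ((m - a) + (b - m)) ≤ (1 + K * (b - a)) * ‖u + w‖ := by
    rw [← map_add, sub_add_sub_cancel', sub_add_sub_cancel', ← abs_of_nonneg hτ]
    exact hx.le_mul_norm a ha b hb
  have hsq : ‖(b - m) • u - (m - a) • w‖ ^ 2 ≤
      (√((1 + K) ^ 4 - 1) * D * ((b - a) ^ 2 * √(b - a))) ^ 2 := by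
    refine (norm_smul_sub_smul_sq_le hα hβ hD (le_add_of_nonneg_right (by positivity))
      hu hw huw).trans ?_
    rw [mul_pow, mul_pow, mul_pow, Real.sq_sqrt hK4, Real.sq_sqrt hτ, sub_add_sub_cancel']
    calc _ ≤ ((1 + K) ^ 4 - 1) * (b - a) * D ^ 2 * (b - a) ^ 4 := by
          gcongr
          exact one_add_mul_pow_le (by positivity) ⟨hτ, by linarith [ha.1, hb.2]⟩ 4
      _ = _ := by ring
  rw [map_sub, map_smul, map_smul]
  exact (sq_le_sq₀ (norm_nonneg _) (by positivity)).1 hsq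

lemma HasChordSpeedOn.exists_hasChordDeviationBoundOn (hx : HasChordSpeedOn L x D K (Icc 0 1))
    (hc : ∀ x, AntilipschitzWith c (L x)) (hD : 0 ≤ D) (hK : 0 ≤ K) :
    ∃ C : ℝ≥0, HasChordDeviationBoundOn x C (Icc 0 1) := by
  refine ⟨c * (√((1 + K) ^ 4 - 1) * D).toNNReal, fun a m b ha hb ham hmb => ?_⟩
  refine ((L (x a)).bound_of_antilipschitz (hc _) _).trans ?_
  rw [NNReal.coe_mul, Real.coe_toNNReal _ (by positivity), mul_assoc (c : ℝ)]
  gcongr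
  exact hx.norm_coframe_chord_deviation_le hD hK ha hb ham hmb

lemma HasChordSpeedOn.norm_coframe_deriv_eq (hx : HasChordSpeedOn L x D K (Icc 0 1)) {t : ℝ}
    (ht : t ∈ Icc (0 : ℝ) 1) {y : E} (hy : HasDerivWithinAt x y (Icc 0 1) t) :
    ‖L (x t) y‖ = D := by
  have : (𝓝[Icc 0 1 \ {t}] t).NeBot := accPt_principal_iff_nhdsWithin.1
    ((uniqueDiffOn_Icc (zero_lt_one' ℝ)).uniqueDiffWithinAt ht).accPt
  have hspeed : Tendsto (fun s => ‖L (x t) (slope x t s)‖) (𝓝[Icc 0 1 \ {t}] t) (𝓝 ‖L (x t) y‖) :=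
    (((L (x t)).continuous.tendsto _).comp (hasDerivWithinAt_iff_tendsto_slope.1 hy)).norm
  have hfactor : Tendsto (fun s => 1 + K * |s - t|) (𝓝[Icc 0 1 \ {t}] t) (𝓝 1) :=
    tendsto_nhdsWithin_of_tendsto_nhds (Continuous.tendsto' (by fun_prop) _ _ (by simp))
  have hchord (s : ℝ) : ‖L (x t) (x s - x t)‖ = |s - t| * ‖L (x t) (slope x t s)‖ := by
    rw [← vsub_eq_sub, ← sub_smul_slope, map_smul, norm_smul, Real.norm_eq_abs]
  apply le_antisymm
  · refine le_of_tendsto_of_tendsto hspeed (by simpa using hfactor.mul_const D) ?_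
    filter_upwards [self_mem_nhdsWithin] with s hs
    have h := hx.norm_le_mul t ht t ht s hs.1
    rw [sub_self, abs_zero, zero_add, hchord] at h
    exact le_of_mul_le_mul_left (by linarith) (abs_pos.2 (sub_ne_zero.2 hs.2))
  · refine ge_of_tendsto (by simpa using hfactor.mul hspeed) ?_
    filter_upwards [self_mem_nhdsWithin] with s hs
    have h := hx.le_mul_norm t ht s hs.1
    rw [hchord] at h
    exact le_of_mul_le_mul_left (by linarith) (abs_pos.2 (sub_ne_zero.2 hs.2))

theorem exists_hasContinuousDerivOn_of_coframeDist_eq [ProperSpace E] [CompleteSpace H]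
    (hL : LocallyLipschitz L) (hc : ∀ x, AntilipschitzWith c (L x)) (hD : 0 ≤ D)
    (hx : ∀ s ∈ Icc (0 : ℝ) 1, ∀ t ∈ Icc (0 : ℝ) 1, coframeDist L (x s) (x t) = D * |t - s|) :
    ∃ g : ℝ → E, HasContinuousDerivOn x g (Icc 0 1) ∧ ∀ t ∈ Icc (0 : ℝ) 1, ‖L (x t) (g t)‖ = D := by
  obtain ⟨K, hK, hspeed⟩ := exists_hasChordSpeedOn hL hc hD hx
  obtain ⟨C, hC⟩ := hspeed.exists_hasChordDeviationBoundOn hc hD hK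
  obtain ⟨g, hg⟩ := hC.exists_hasContinuousDerivOn one_pos
  exact ⟨g, hg, fun t ht => hspeed.norm_coframe_deriv_eq ht (hg.hasDerivWithinAt t ht)⟩

end ProportionalCurve

section HopfRinow

variable {E H : Type*} [NormedAddCommGroup E] [NormedSpace ℝ E] [NormedAddCommGroup H]
  [NormedSpace ℝ H] {L : E → E →L[ℝ] H} {c : ℝ≥0} {x y : E}

lemma tendsto_coframeDist_self [ProperSpace E] (hL : LocallyLipschitz L)
    (hc : ∀ x, AntilipschitzWith c (L x)) (y : E) :
    Tendsto (fun z => coframeDist L y z) (𝓝 y) (𝓝 0) := by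
  obtain ⟨B, hB⟩ := exists_hasDistortionBoundOn hL hc (isCompact_closedBall y 1)
  refine squeeze_zero' (Eventually.of_forall fun _ => coframeDist_nonneg) ?_
    (Continuous.tendsto' (f := fun z => (1 + B * ‖z - y‖) * ‖L y (z - y)‖) (by fun_prop) y 0
      (by simp))
  filter_upwards [Metric.closedBall_mem_nhds y one_pos] with z hz
  exact coframeDist_le_one_add_mul_norm hL.continuous hB (convex_closedBall _ _)
    (Metric.mem_closedBall_self zero_le_one) hz

lemma continuous_coframeDist [ProperSpace E] (hL : LocallyLipschitz L)
    (hc : ∀ x, AntilipschitzWith c (L x)) :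
    Continuous fun p : E × E => coframeDist L p.1 p.2 := by
  refine continuous_iff_continuousAt.2 fun p => tendsto_iff_dist_tendsto_zero.2 ?_
  have hlim : Tendsto (fun q : E × E => coframeDist L p.1 q.1 + coframeDist L p.2 q.2) (𝓝 p)
      (𝓝 (0 + 0)) :=
    ((tendsto_coframeDist_self hL hc p.1).comp continuousAt_fst).add
      ((tendsto_coframeDist_self hL hc p.2).comp continuousAt_snd)
  rw [add_zero] at hlim
  refine squeeze_zero (fun _ => dist_nonneg) (fun q => ?_) hlim
  have htriangle (x y x' y' : E) :
      coframeDist L x y ≤ coframeDist L x x' + coframeDist L x' y' + coframeDist L y' y :=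
    (coframeDist_triangle hL.continuous).trans
      (add_le_add_left (coframeDist_triangle hL.continuous) _)
  have hp := htriangle p.1 p.2 q.1 q.2
  have hq := htriangle q.1 q.2 p.1 p.2
  rw [coframeDist_comm (x := q.2) (y := p.2)] at hp
  rw [coframeDist_comm (x := q.1) (y := p.1)] at hq
  rw [Real.dist_eq, abs_le]
  constructor <;> linarith

lemma exists_monotoneOn_apply_eq_lineMap {ℓ : ℝ → ℝ} (hmono : StrictMonoOn ℓ (Icc 0 1))
    (hcont : ContinuousOn ℓ (Icc 0 1)) :
    ∃ τ : ℝ → ℝ, τ 0 = 0 ∧ τ 1 = 1 ∧ MapsTo τ (Icc 0 1) (Icc 0 1) ∧ MonotoneOn τ (Icc 0 1) ∧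
      ∀ s ∈ Icc (0 : ℝ) 1, ℓ (τ s) = AffineMap.lineMap (ℓ 0) (ℓ 1) s := by
  have h0 : (0 : ℝ) ∈ Icc (0 : ℝ) 1 := left_mem_Icc.2 zero_le_one
  have h1 : (1 : ℝ) ∈ Icc (0 : ℝ) 1 := right_mem_Icc.2 zero_le_one
  have h01 : ℓ 0 < ℓ 1 := hmono h0 h1 one_pos
  have hex : ∀ s ∈ Icc (0 : ℝ) 1, ∃ u ∈ Icc (0 : ℝ) 1, ℓ u = AffineMap.lineMap (ℓ 0) (ℓ 1) s :=
    fun s hs => intermediate_value_Icc zero_le_one hcont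
      ⟨(left_le_lineMap_iff_nonneg h01).2 hs.1, (lineMap_le_right_iff_le_one h01).2 hs.2⟩
  choose! τ hτI hℓτ using hex
  refine ⟨τ, hmono.injOn (hτI 0 h0) h0 ?_, hmono.injOn (hτI 1 h1) h1 ?_, hτI,
    fun s hs t ht hst => (hmono.le_iff_le (hτI s hs) (hτI t ht)).1 ?_, hℓτ⟩
  · rw [hℓτ 0 h0, AffineMap.lineMap_apply_zero]
  · rw [hℓτ 1 h1, AffineMap.lineMap_apply_one]
  · rw [hℓτ s hs, hℓτ t ht]
    exact AffineMap.lineMap_mono h01.le hst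

/-- The path is reparametrized by its arc length, to which a multiple of `t` is added to make it
strictly increasing. -/
lemma exists_curve_coframeDist_le_of_lt (hL : Continuous L) {r : ℝ} (hr : coframeDist L x y < r) :
    ∃ ξ : ℝ → E, ξ 0 = x ∧ ξ 1 = y ∧ ∀ s ∈ Icc (0 : ℝ) 1, ∀ t ∈ Icc (0 : ℝ) 1, s ≤ t →
      coframeDist L (ξ s) (ξ t) ≤ r * (t - s) := by
  obtain ⟨γ, γ', hγ, rfl, rfl, hlt⟩ := exists_path_of_coframeDist_lt hL hr
  have h0 : (0 : ℝ) ∈ Icc (0 : ℝ) 1 := left_mem_Icc.2 zero_le_one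
  have h1 : (1 : ℝ) ∈ Icc (0 : ℝ) 1 := right_mem_Icc.2 zero_le_one
  let speed : ℝ → ℝ := fun t => ‖L (γ t) (γ' t)‖
  let slack : ℝ := r - ∫ t in (0 : ℝ)..1, speed t
  have hslack : 0 < slack := sub_pos.2 hlt
  have hspeed {a b : ℝ} (ha : a ∈ Icc (0 : ℝ) 1) (hb : b ∈ Icc (0 : ℝ) 1) :
      IntervalIntegrable speed volume a b :=
    ((hγ.continuousOn_norm_coframe hL).mono (uIcc_subset_Icc ha hb)).intervalIntegrable
  let ℓ : ℝ → ℝ := fun t => (∫ u in (0 : ℝ)..t, speed u) + slack * t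
  have hℓ_sub {a b : ℝ} (ha : a ∈ Icc (0 : ℝ) 1) (hb : b ∈ Icc (0 : ℝ) 1) :
      ℓ b - ℓ a = (∫ t in a..b, speed t) + slack * (b - a) := by
    rw [← intervalIntegral.integral_interval_sub_left (hspeed h0 hb) (hspeed h0 ha)]
    ring
  have hℓ_mono : StrictMonoOn ℓ (Icc 0 1) := fun a ha b hb hab => by
    have hlength : 0 ≤ ∫ t in a..b, speed t :=
      intervalIntegral.integral_nonneg hab.le fun _ _ => norm_nonneg _
    linarith [hℓ_sub ha hb, mul_pos hslack (sub_pos.2 hab)]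
  have hℓ_cont : ContinuousOn ℓ (Icc 0 1) := by
    have h := intervalIntegral.continuousOn_primitive_interval' (hspeed h0 h1) left_mem_uIcc
    rw [uIcc_of_le zero_le_one] at h
    exact h.add (by fun_prop)
  obtain ⟨τ, hτ0, hτ1, hτI, hτ_mono, hℓτ⟩ := exists_monotoneOn_apply_eq_lineMap hℓ_mono hℓ_cont
  refine ⟨γ ∘ τ, by simp [hτ0], by simp [hτ1], fun s hs t ht hst => ?_⟩
  have hle : τ s ≤ τ t := hτ_mono hs ht hst
  calc coframeDist L (γ (τ s)) (γ (τ t)) ≤ ∫ u in τ s..τ t, speed u :=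
        coframeDist_le_integral hL hle (hγ.mono (Icc_subset_Icc (hτI hs).1 (hτI ht).2))
    _ ≤ ℓ (τ t) - ℓ (τ s) := by
        rw [hℓ_sub (hτI hs) (hτI ht)]
        exact le_add_of_nonneg_right (mul_nonneg hslack.le (sub_nonneg.2 hle))
    _ = r * (t - s) := by
        simp only [hℓτ s hs, hℓτ t ht, AffineMap.lineMap_apply_ring', ℓ, slack,
          intervalIntegral.integral_same]
        ring

theorem exists_curve_coframeDist_le [ProperSpace E] (hL : LocallyLipschitz L)
    (hc : ∀ x, AntilipschitzWith c (L x)) (x y : E) :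
    ∃ ξ : ℝ → E, ξ 0 = x ∧ ξ 1 = y ∧ ∀ s ∈ Icc (0 : ℝ) 1, ∀ t ∈ Icc (0 : ℝ) 1, s ≤ t →
      coframeDist L (ξ s) (ξ t) ≤ coframeDist L x y * (t - s) := by
  let d := coframeDist L x y
  have happrox : ∀ r, d < r → _ := fun r hr => exists_curve_coframeDist_le_of_lt hL.continuous hr
  choose! ξ hξ0 hξ1 hξ using happrox
  let F : Ultrafilter ℝ := Ultrafilter.of (𝓝[>] d)
  have hF : (F : Filter ℝ) ≤ 𝓝[>] d := Ultrafilter.of_le _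
  have hgt : ∀ᶠ r in F, d < r := hF self_mem_nhdsWithin
  have h0 : (0 : ℝ) ∈ Icc (0 : ℝ) 1 := left_mem_Icc.2 zero_le_one
  have h1 : (1 : ℝ) ∈ Icc (0 : ℝ) 1 := right_mem_Icc.2 zero_le_one
  have hlim : ∀ t ∈ Icc (0 : ℝ) 1, ∃ z, Tendsto (fun r => ξ r t) F (𝓝 z) := fun t ht => by
    have hball : ∀ᶠ r in F, ξ r t ∈ Metric.closedBall x (c * (d + 1)) := by
      filter_upwards [hgt, hF (mem_nhdsWithin_of_mem_nhds (Iio_mem_nhds (lt_add_one d)))]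
        with r hr hr1
      rw [mem_closedBall_iff_norm', ← hξ0 r hr]
      refine (norm_sub_le_mul_coframeDist hL.continuous hc _ _).trans ?_
      gcongr
      have hr0 : 0 ≤ r := coframeDist_nonneg.trans hr.le
      refine (hξ r hr 0 h0 t ht ht.1).trans ?_
      rw [sub_zero]
      exact (mul_le_of_le_one_right hr0 ht.2).trans (le_of_lt hr1)
    obtain ⟨z, -, hz⟩ := (isCompact_closedBall x (c * (d + 1))).ultrafilter_le_nhds
      (F.map fun r => ξ r t) (le_principal_iff.2 hball)
    exact ⟨z, hz⟩
  choose! ζ hζ using hlim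
  refine ⟨ζ, tendsto_nhds_unique_of_eventuallyEq (hζ 0 h0) tendsto_const_nhds (hgt.mono hξ0),
    tendsto_nhds_unique_of_eventuallyEq (hζ 1 h1) tendsto_const_nhds (hgt.mono hξ1),
    fun s hs t ht hst => ?_⟩
  refine le_of_tendsto_of_tendsto
    ((continuous_coframeDist hL hc).tendsto _ |>.comp ((hζ s hs).prodMk_nhds (hζ t ht)))
    ((tendsto_id.mono_left (hF.trans nhdsWithin_le_nhds)).mul_const (t - s)) ?_
  filter_upwards [hgt] with r hr using hξ r hr s hs t ht hst

lemma coframeDist_eq_of_le (hL : Continuous L) {ξ : ℝ → E}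
    (hξ : ∀ s ∈ Icc (0 : ℝ) 1, ∀ t ∈ Icc (0 : ℝ) 1, s ≤ t →
      coframeDist L (ξ s) (ξ t) ≤ coframeDist L (ξ 0) (ξ 1) * (t - s)) {s t : ℝ}
    (hs : s ∈ Icc (0 : ℝ) 1) (ht : t ∈ Icc (0 : ℝ) 1) :
    coframeDist L (ξ s) (ξ t) = coframeDist L (ξ 0) (ξ 1) * |t - s| := by
  wlog hst : s ≤ t generalizing s t
  · rw [coframeDist_comm, abs_sub_comm]
    exact this ht hs (le_of_not_ge hst)
  rw [abs_of_nonneg (sub_nonneg.2 hst)]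
  refine le_antisymm (hξ s hs t ht hst) ?_
  have hstart := hξ 0 (left_mem_Icc.2 zero_le_one) s hs hs.1
  have hend := hξ t ht 1 (right_mem_Icc.2 zero_le_one) ht.2
  have htriangle₁ := coframeDist_triangle hL (x := ξ 0) (y := ξ s) (z := ξ 1)
  have htriangle₂ := coframeDist_triangle hL (x := ξ s) (y := ξ t) (z := ξ 1)
  linarith

end HopfRinow

section KernelGeodesic

variable {n : ℕ} {V : Type*} [NormedAddCommGroup V] [InnerProductSpace ℝ V] [CompleteSpace V]
  [RKHS ℝ V (EuclideanSpace ℝ (Fin n)) (EuclideanSpace ℝ (Fin n))] {c : ℝ≥0}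
  {x : ℝ → EuclideanSpace ℝ (Fin n)}

theorem isKernelGeodesic_of_coframeDist_le
    (hV : EmbedsInBoundedLipschitz V (X := EuclideanSpace ℝ (Fin n)) c)
    (hK : ∀ x : EuclideanSpace ℝ (Fin n), (RKHS.kernel V x x).IsInvertible)
    (hx : ∀ s ∈ Icc (0 : ℝ) 1, ∀ t ∈ Icc (0 : ℝ) 1, s ≤ t →
      coframeDist (minLift V) (x s) (x t) ≤ coframeDist (minLift V) (x 0) (x 1) * (t - s)) :
    IsKernelGeodesic V (x 0) (x 1) x := by
  have hL : LocallyLipschitz (minLift V) := hV.locallyLipschitz_minLift hK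
  obtain ⟨g, hg, hspeed⟩ := exists_hasContinuousDerivOn_of_coframeDist_eq hL
    (fun z => hV.antilipschitzWith_minLift (hK z)) coframeDist_nonneg
    fun s hs t ht => coframeDist_eq_of_le hL.continuous hx hs ht
  have hunique := uniqueDiffOn_Icc (zero_lt_one' ℝ)
  refine ⟨hg.contDiffOn hunique, rfl, rfl, fun t ht => ?_⟩
  rw [kernelSpeed_eq_enorm_minLift (hK _), (hg.hasDerivWithinAt t ht).derivWithin (hunique t ht),
    ← ofReal_norm, hspeed t ht, ofReal_coframeDist hL.continuous, kernelEDist_eq_coframeEDist hK]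

theorem exists_isKernelGeodesic
    (hV : EmbedsInBoundedLipschitz V (X := EuclideanSpace ℝ (Fin n)) c)
    (hK : ∀ x : EuclideanSpace ℝ (Fin n), (RKHS.kernel V x x).IsInvertible)
    (x₀ x₁ : EuclideanSpace ℝ (Fin n)) : ∃ x, IsKernelGeodesic V x₀ x₁ x := by
  obtain ⟨x, rfl, rfl, hx⟩ := exists_curve_coframeDist_le (hV.locallyLipschitz_minLift hK)
    (fun z => hV.antilipschitzWith_minLift (hK z)) x₀ x₁
  exact ⟨x, isKernelGeodesic_of_coframeDist_le hV hK hx⟩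

end KernelGeodesic

section Flow

variable {F : Type*} [NormedAddCommGroup F] [NormedSpace ℝ F] {f : ℝ → F → F} {K : ℝ≥0}
  {a b s t : ℝ} {α β : ℝ → F}

lemma dist_le_mul_exp_of_isIntegralCurveOn_of_le (hf : ∀ t ∈ Icc a b, LipschitzWith K (f t))
    (hα : IsIntegralCurveOn α f (Icc a b)) (hβ : IsIntegralCurveOn β f (Icc a b))
    (hs : s ∈ Icc a b) (ht : t ∈ Icc a b) (hst : s ≤ t) :
    dist (α t) (β t) ≤ dist (α s) (β s) * Real.exp (K * (t - s)) := by
  have hsub : Icc s t ⊆ Icc a b := Icc_subset_Icc hs.1 ht.2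
  have hright {γ : ℝ → F} (hγ : IsIntegralCurveOn γ f (Icc a b)) (r : ℝ) (hr : r ∈ Ico s t) :
      HasDerivWithinAt γ (f r (γ r)) (Ici r) r :=
    (hγ.mono hsub r (Ico_subset_Icc_self hr)).mono_of_mem_nhdsWithin (Icc_mem_nhdsGE_of_mem hr)
  exact dist_le_of_trajectories_ODE_of_mem (s := fun _ => univ)
    (fun r hr => (hf r (hsub (Ico_subset_Icc_self hr))).lipschitzOnWith)
    (hα.mono hsub).continuousOn (hright hα) (fun _ _ => mem_univ _) (hβ.mono hsub).continuousOn
    (hright hβ) (fun _ _ => mem_univ _) le_rfl t (right_mem_Icc.2 hst)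

theorem dist_le_mul_exp_of_isIntegralCurveOn (hf : ∀ t ∈ Icc a b, LipschitzWith K (f t))
    (hα : IsIntegralCurveOn α f (Icc a b)) (hβ : IsIntegralCurveOn β f (Icc a b))
    (hs : s ∈ Icc a b) (ht : t ∈ Icc a b) :
    dist (α t) (β t) ≤ dist (α s) (β s) * Real.exp (K * |t - s|) := by
  rcases le_total s t with hst | hts
  · rw [abs_of_nonneg (sub_nonneg.2 hst)]
    exact dist_le_mul_exp_of_isIntegralCurveOn_of_le hf hα hβ hs ht hst
  · have hneg : {r : ℝ | r * -1 ∈ Icc a b} = Icc (-b) (-a) := by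
      ext r
      simp only [mul_neg_one, mem_ofPred_eq, mem_Icc, le_neg, neg_le, and_comm]
    have hα' := hα.comp_mul (-1)
    have hβ' := hβ.comp_mul (-1)
    rw [hneg] at hα' hβ'
    have hmem {r : ℝ} (hr : r ∈ Icc a b) : -r ∈ Icc (-b) (-a) :=
      ⟨neg_le_neg hr.2, neg_le_neg hr.1⟩
    have hdist := dist_le_mul_exp_of_isIntegralCurveOn_of_le (K := K)
      (fun r hr => by
        simpa using (hf (r * -1) (hneg.symm ▸ hr : r ∈ {r : ℝ | r * -1 ∈ Icc a b})).neg)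
      hα' hβ' (hmem hs) (hmem ht) (neg_le_neg hts)
    rw [abs_of_nonpos (sub_nonpos.2 hts)]
    simpa [neg_add_eq_sub] using hdist

lemma isIntegralCurveOn_apply_eq (hf : ∀ t ∈ Icc a b, LipschitzWith K (f t))
    (hα : IsIntegralCurveOn α f (Icc a b)) (hβ : IsIntegralCurveOn β f (Icc a b))
    (hs : s ∈ Icc a b) (ht : t ∈ Icc a b) (h : α s = β s) : α t = β t := by
  simpa [h] using dist_le_mul_exp_of_isIntegralCurveOn hf hα hβ hs ht

variable [CompleteSpace F]

lemma exists_isIntegralCurveOn_Icc {M : ℝ≥0} (hf : ∀ t ∈ Icc a b, LipschitzWith K (f t))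
    (hcont : ∀ y, ContinuousOn (fun t => f t y) (Icc a b))
    (hM : ∀ t ∈ Icc a b, ∀ y, ‖f t y‖ ≤ M) (ht : t ∈ Icc a b) (y : F) :
    ∃ α : ℝ → F, α t = y ∧ IsIntegralCurveOn α f (Icc a b) := by
  have hab : a ≤ b := ht.1.trans ht.2
  have hPL : IsPicardLindelof f ⟨t, ht⟩ y (M * (b - a).toNNReal) 0 M K :=
    { lipschitzOnWith := fun s hs => (hf s hs).lipschitzOnWith
      continuousOn := fun z _ => hcont z
      norm_le := fun s hs z _ => hM s hs z
      mul_max_le := by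
        rw [NNReal.coe_mul, Real.coe_toNNReal _ (sub_nonneg.2 hab), NNReal.coe_zero, sub_zero]
        gcongr
        exact max_le (sub_le_sub_left ht.1 b) (sub_le_sub_right ht.2 a) }
  exact hPL.exists_eq_forall_mem_Icc_hasDerivWithinAt₀

theorem exists_homeomorph_apply_eq_of_isIntegralCurveOn {M : ℝ≥0}
    (hf : ∀ t ∈ Icc a b, LipschitzWith K (f t))
    (hcont : ∀ y, ContinuousOn (fun t => f t y) (Icc a b))
    (hM : ∀ t ∈ Icc a b, ∀ y, ‖f t y‖ ≤ M) (hs : s ∈ Icc a b) (ht : t ∈ Icc a b) :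
    ∃ e : F ≃ₜ F, ∀ α : ℝ → F, IsIntegralCurveOn α f (Icc a b) → e (α s) = α t := by
  choose A hA hAf using exists_isIntegralCurveOn_Icc hf hcont hM hs
  choose B hB hBf using exists_isIntegralCurveOn_Icc hf hcont hM ht
  have hA_eq (α : ℝ → F) (hα : IsIntegralCurveOn α f (Icc a b)) : A (α s) t = α t :=
    isIntegralCurveOn_apply_eq hf (hAf _) hα hs ht (hA _)
  have hB_eq (α : ℝ → F) (hα : IsIntegralCurveOn α f (Icc a b)) : B (α t) s = α s :=
    isIntegralCurveOn_apply_eq hf (hBf _) hα ht hs (hB _)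
  have hcontA : Continuous fun y => A y t :=
    (LipschitzWith.of_dist_le_mul (K := (Real.exp (K * |t - s|)).toNNReal) fun y z => by
      simpa [hA, mul_comm, Real.exp_nonneg] using
        dist_le_mul_exp_of_isIntegralCurveOn hf (hAf y) (hAf z) hs ht).continuous
  have hcontB : Continuous fun y => B y s :=
    (LipschitzWith.of_dist_le_mul (K := (Real.exp (K * |s - t|)).toNNReal) fun y z => by
      simpa [hB, mul_comm, Real.exp_nonneg] using
        dist_le_mul_exp_of_isIntegralCurveOn hf (hBf y) (hBf z) ht hs).continuous
  exact ⟨{ toFun := fun y => A y t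
           invFun := fun y => B y s
           left_inv := fun y => (hB_eq _ (hAf y)).trans (hA y)
           right_inv := fun y => (hA_eq _ (hBf y)).trans (hB y)
           continuous_toFun := hcontA
           continuous_invFun := hcontB }, hA_eq⟩

end Flow

section FlowOfField

variable {n : ℕ} {V : Type*} [NormedAddCommGroup V] [InnerProductSpace ℝ V]
  [RKHS ℝ V (EuclideanSpace ℝ (Fin n)) (EuclideanSpace ℝ (Fin n))] {c : ℝ≥0}

theorem exists_isFlow (hV : EmbedsInBoundedLipschitz V (X := EuclideanSpace ℝ (Fin n)) c)
    {v : ℝ → V} (hv : ContinuousOn v (Icc 0 1)) :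
    ∃ φ : ℝ → EuclideanSpace ℝ (Fin n) ≃ₜ EuclideanSpace ℝ (Fin n), IsFlow v φ ∧
      ∀ x, IsIntegralCurveOn x (fun t y => v t y) (Icc 0 1) →
        ∀ t ∈ Icc (0 : ℝ) 1, φ t (x 0) = x t := by
  have h0 : (0 : ℝ) ∈ Icc (0 : ℝ) 1 := left_mem_Icc.2 zero_le_one
  obtain ⟨M, hM⟩ := isCompact_Icc.exists_bound_of_continuousOn hv
  have hM' (t : ℝ) (ht : t ∈ Icc (0 : ℝ) 1) : ‖v t‖ ≤ M.toNNReal :=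
    (hM t ht).trans (Real.le_coe_toNNReal M)
  have hlip (t : ℝ) (ht : t ∈ Icc (0 : ℝ) 1) : LipschitzWith (c * M.toNNReal) (v t) :=
    (hV.lipschitzWith (v t)).weaken (by gcongr; exact hM' t ht)
  have hcont (y : EuclideanSpace ℝ (Fin n)) : ContinuousOn (fun t => v t y) (Icc 0 1) :=
    (RKHS.continuous_eval (𝕜 := ℝ) (H := V) y).comp_continuousOn hv
  have hbound (t : ℝ) (ht : t ∈ Icc (0 : ℝ) 1) (y : EuclideanSpace ℝ (Fin n)) :
      ‖v t y‖ ≤ (c * M.toNNReal : ℝ≥0) :=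
    (hV.norm_apply_le (v t) y).trans (by push_cast; gcongr; exact hM' t ht)
  choose! φ hφ using fun t (ht : t ∈ Icc (0 : ℝ) 1) =>
    exists_homeomorph_apply_eq_of_isIntegralCurveOn hlip hcont hbound h0 ht
  refine ⟨φ, fun y => ?_, fun x hx t ht => hφ t ht x hx⟩
  obtain ⟨x, rfl, hx⟩ := exists_isIntegralCurveOn_Icc hlip hcont hbound h0 y
  have hφx (t : ℝ) (ht : t ∈ Icc (0 : ℝ) 1) : φ t (x 0) = x t := hφ t ht x hx
  have hvx : ContinuousOn (fun t => v t (x t)) (Icc 0 1) :=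
    (continuousOn_prod_of_continuousOn_lipschitzOnWith'
      (fun p : ℝ × EuclideanSpace ℝ (Fin n) => v p.1 p.2) _
      (fun t ht => (hlip t ht).lipschitzOnWith) fun y _ => hcont y).comp
        (continuousOn_id.prodMk hx.continuousOn) fun t ht => ⟨ht, mem_univ _⟩
  refine ⟨(hvx.congr fun t ht => by rw [hφx t ht]).intervalIntegrable_of_Icc zero_le_one,
    fun t ht => ?_⟩
  have hsub : Icc 0 t ⊆ Icc (0 : ℝ) 1 := Icc_subset_Icc_right ht.2
  have hcongr : ∫ s in (0 : ℝ)..t, v s (φ s (x 0)) = ∫ s in (0 : ℝ)..t, v s (x s) :=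
    intervalIntegral.integral_congr fun s hs => by
      rw [uIcc_of_le ht.1] at hs
      simp only [hφx s (hsub hs)]
  rw [hφx t ht, hcongr, HasContinuousDerivOn.integral_eq_sub ht.1
    (HasContinuousDerivOn.mk (fun s hs => hx.mono hsub s hs) (hvx.mono hsub)), add_sub_cancel]

end FlowOfField

section SquareIntegrable

variable {Ω : Type*} [MeasurableSpace Ω] {μ : Measure Ω}

lemma lintegral_enorm_sq_eq_ofReal {W : Type*} [NormedAddCommGroup W] {f : Ω → W}
    (hf : MemLp f 2 μ) : ∫⁻ ω, ‖f ω‖ₑ ^ 2 ∂μ = ENNReal.ofReal (∫ ω, ‖f ω‖ ^ 2 ∂μ) := by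
  rw [ofReal_integral_eq_lintegral_ofReal (hf.integrable_norm_pow two_ne_zero)
    (ae_of_all _ fun _ => by positivity)]
  simp only [ENNReal.ofReal_pow (norm_nonneg _), ofReal_norm]

variable [IsProbabilityMeasure μ] {X : Ω → ℝ}

lemma sq_integral_le_integral_sq (hX : MemLp X 2 μ) : (∫ ω, X ω ∂μ) ^ 2 ≤ ∫ ω, X ω ^ 2 ∂μ :=
  sub_nonneg.1 ((ProbabilityTheory.variance_nonneg X μ).trans_eq
    (ProbabilityTheory.variance_eq_sub hX))

lemma ae_eq_integral_of_integral_sq_le (hX : MemLp X 2 μ)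
    (hle : ∫ ω, X ω ^ 2 ∂μ ≤ (∫ ω, X ω ∂μ) ^ 2) : ∀ᵐ ω ∂μ, X ω = ∫ ω, X ω ∂μ := by
  refine ProbabilityTheory.ae_eq_integral_of_variance_eq_zero hX
    (le_antisymm ?_ (ProbabilityTheory.variance_nonneg X μ))
  rw [ProbabilityTheory.variance_eq_sub hX]
  exact sub_nonpos.2 hle

end SquareIntegrable

section UnitInterval

instance isProbabilityMeasure_restrict_Icc_zero_one :
    IsProbabilityMeasure (volume.restrict (Icc (0 : ℝ) 1)) :=
  ⟨by simp⟩

lemma setIntegral_Icc_zero_one_eq {E : Type*} [NormedAddCommGroup E] [NormedSpace ℝ E]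
    (f : ℝ → E) : ∫ t in Icc (0 : ℝ) 1, f t = ∫ t in (0 : ℝ)..1, f t := by
  rw [intervalIntegral.integral_of_le zero_le_one, integral_Icc_eq_integral_Ioc]

lemma intervalIntegral_eq_of_ae_eq_const {f : ℝ → ℝ} {a s t : ℝ}
    (hf : ∀ᵐ r ∂volume.restrict (Icc (0 : ℝ) 1), f r = a) (hs : s ∈ Icc (0 : ℝ) 1)
    (ht : t ∈ Icc (0 : ℝ) 1) : ∫ r in s..t, f r = a * (t - s) := by
  have hst : uIoc s t ⊆ Icc 0 1 := uIoc_subset_uIcc.trans (uIcc_subset_Icc hs ht)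
  rw [intervalIntegral.integral_congr_ae_restrict (ae_restrict_of_ae_restrict_of_subset hst hf),
    intervalIntegral.integral_const, smul_eq_mul, mul_comm]

variable {n : ℕ} {η : ℝ → EuclideanSpace ℝ (Fin n) → ℝ} {x : EuclideanSpace ℝ (Fin n)}

lemma integral_eq_two_mul_sqrtWeight_sub_one (η : ℝ → EuclideanSpace ℝ (Fin n) → ℝ)
    (x : EuclideanSpace ℝ (Fin n)) :
    ∫ t in Icc (0 : ℝ) 1, η t x = 2 * (sqrtWeight η 1 x - 1) := by
  rw [sqrtWeight, setIntegral_Icc_zero_one_eq]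
  ring

lemma four_mul_sq_sqrtWeight_sub_one_le
    (hη : MemLp (fun t => η t x) 2 (volume.restrict (Icc (0 : ℝ) 1))) :
    4 * (sqrtWeight η 1 x - 1) ^ 2 ≤ ∫ t in Icc (0 : ℝ) 1, η t x ^ 2 := by
  have hsq := sq_integral_le_integral_sq hη
  rw [integral_eq_two_mul_sqrtWeight_sub_one] at hsq
  linarith

lemma sqrtWeight_eq_lineMap_of_integral_sq_le
    (hη : MemLp (fun t => η t x) 2 (volume.restrict (Icc (0 : ℝ) 1)))
    (hle : ∫ t in Icc (0 : ℝ) 1, η t x ^ 2 ≤ 4 * (sqrtWeight η 1 x - 1) ^ 2) {t : ℝ}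
    (ht : t ∈ Icc (0 : ℝ) 1) :
    sqrtWeight η t x = AffineMap.lineMap 1 (sqrtWeight η 1 x) t := by
  have hconst := ae_eq_integral_of_integral_sq_le hη
    (by rw [integral_eq_two_mul_sqrtWeight_sub_one]; linarith)
  rw [integral_eq_two_mul_sqrtWeight_sub_one] at hconst
  rw [sqrtWeight, intervalIntegral_eq_of_ae_eq_const hconst (left_mem_Icc.2 zero_le_one) ht,
    AffineMap.lineMap_apply_ring']
  ring

lemma sqrtWeight_const (a t : ℝ) (x : EuclideanSpace ℝ (Fin n)) :
    sqrtWeight (fun _ _ => 2 * (a - 1)) t x = AffineMap.lineMap 1 a t := by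
  rw [sqrtWeight, intervalIntegral.integral_const, AffineMap.lineMap_apply_ring', smul_eq_mul]
  ring

end UnitInterval

section TrajectoryEnergy

variable {n : ℕ} {V : Type*} [NormedAddCommGroup V] [InnerProductSpace ℝ V]
  [RKHS ℝ V (EuclideanSpace ℝ (Fin n)) (EuclideanSpace ℝ (Fin n))] {c : ℝ≥0} {v : ℝ → V}
  {φ : ℝ → EuclideanSpace ℝ (Fin n) ≃ₜ EuclideanSpace ℝ (Fin n)} {x₀ x₁ : EuclideanSpace ℝ (Fin n)}

lemma IsFlow.apply_zero (hφ : IsFlow v φ) (x : EuclideanSpace ℝ (Fin n)) : φ 0 x = x := by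
  simpa using (hφ x).2 0 (left_mem_Icc.2 zero_le_one)

lemma IsFlow.apply_eq_add_integral (hφ : IsFlow v φ) (x : EuclideanSpace ℝ (Fin n)) {s t : ℝ}
    (hs : s ∈ Icc (0 : ℝ) 1) (ht : t ∈ Icc (0 : ℝ) 1) :
    φ t x = φ s x + ∫ r in s..t, v r (φ r x) := by
  have hint {r : ℝ} (hr : r ∈ Icc (0 : ℝ) 1) :
      IntervalIntegrable (fun r => v r (φ r x)) volume 0 r :=
    (hφ x).1.mono_set (by simpa only [uIcc_of_le hr.1, uIcc_of_le zero_le_one] using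
      Icc_subset_Icc_right hr.2)
  rw [(hφ x).2 t ht, (hφ x).2 s hs, add_assoc,
    intervalIntegral.integral_add_adjacent_intervals (hint hs) ((hint hs).symm.trans (hint ht))]

variable [CompleteSpace V]

theorem IsFlow.coframeDist_le_integral_norm
    (hV : EmbedsInBoundedLipschitz V (X := EuclideanSpace ℝ (Fin n)) c)
    (hK : ∀ x : EuclideanSpace ℝ (Fin n), (RKHS.kernel V x x).IsInvertible) (hφ : IsFlow v φ)
    (hv : MemLp v 2 (volume.restrict (Icc (0 : ℝ) 1))) (x : EuclideanSpace ℝ (Fin n)) {s t : ℝ}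
    (hs : s ∈ Icc (0 : ℝ) 1) (ht : t ∈ Icc (0 : ℝ) 1) (hst : s ≤ t) :
    coframeDist (minLift V) (φ s x) (φ t x) ≤ ∫ r in s..t, ‖v r‖ := by
  have hsub : uIcc s t ⊆ uIcc 0 1 := by
    simpa only [uIcc_of_le zero_le_one] using uIcc_subset_Icc hs ht
  have hnorm : IntervalIntegrable (fun r => ‖v r‖) volume 0 1 :=
    (intervalIntegrable_iff_integrableOn_Icc_of_le zero_le_one).2
      (hv.integrable one_le_two).norm
  rw [hφ.apply_eq_add_integral x hs ht]
  refine coframeDist_le_integral_of_eq_primitive (hV.locallyLipschitz_minLift hK)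
    (fun z => hV.antilipschitzWith_minLift (hK z)) hst ((hφ x).1.mono_set hsub)
    (hnorm.mono_set hsub) fun r hr => ?_
  rw [← hφ.apply_eq_add_integral x hs ⟨hs.1.trans hr.1, hr.2.trans ht.2⟩]
  exact norm_minLift_apply_le (hK _) (v r)

lemma IsFlow.coframeDist_zero_one_le_integral_norm
    (hV : EmbedsInBoundedLipschitz V (X := EuclideanSpace ℝ (Fin n)) c)
    (hK : ∀ x : EuclideanSpace ℝ (Fin n), (RKHS.kernel V x x).IsInvertible) (hφ : IsFlow v φ)
    (hv : MemLp v 2 (volume.restrict (Icc (0 : ℝ) 1))) (x : EuclideanSpace ℝ (Fin n)) :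
    coframeDist (minLift V) (φ 0 x) (φ 1 x) ≤ ∫ t in Icc (0 : ℝ) 1, ‖v t‖ := by
  rw [setIntegral_Icc_zero_one_eq]
  exact hφ.coframeDist_le_integral_norm hV hK hv x (left_mem_Icc.2 zero_le_one)
    (right_mem_Icc.2 zero_le_one) zero_le_one

lemma IsFlow.sq_coframeDist_le_integral_norm_sq
    (hV : EmbedsInBoundedLipschitz V (X := EuclideanSpace ℝ (Fin n)) c)
    (hK : ∀ x : EuclideanSpace ℝ (Fin n), (RKHS.kernel V x x).IsInvertible) (hφ : IsFlow v φ)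
    (hv : MemLp v 2 (volume.restrict (Icc (0 : ℝ) 1))) (x : EuclideanSpace ℝ (Fin n)) :
    coframeDist (minLift V) (φ 0 x) (φ 1 x) ^ 2 ≤ ∫ t in Icc (0 : ℝ) 1, ‖v t‖ ^ 2 :=
  (pow_le_pow_left₀ coframeDist_nonneg
    (hφ.coframeDist_zero_one_le_integral_norm hV hK hv x) 2).trans
      (sq_integral_le_integral_sq hv.norm)

theorem IsFlow.isKernelGeodesic_of_integral_norm_sq_le
    (hV : EmbedsInBoundedLipschitz V (X := EuclideanSpace ℝ (Fin n)) c)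
    (hK : ∀ x : EuclideanSpace ℝ (Fin n), (RKHS.kernel V x x).IsInvertible) (hφ : IsFlow v φ)
    (hv : MemLp v 2 (volume.restrict (Icc (0 : ℝ) 1))) {x : EuclideanSpace ℝ (Fin n)}
    (hle : ∫ t in Icc (0 : ℝ) 1, ‖v t‖ ^ 2 ≤ coframeDist (minLift V) (φ 0 x) (φ 1 x) ^ 2) :
    IsKernelGeodesic V (φ 0 x) (φ 1 x) fun t => φ t x := by
  have hlength : ∫ t in Icc (0 : ℝ) 1, ‖v t‖ = coframeDist (minLift V) (φ 0 x) (φ 1 x) :=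
    le_antisymm
      ((sq_le_sq₀ (integral_nonneg fun _ => norm_nonneg _) coframeDist_nonneg).1
        ((sq_integral_le_integral_sq hv.norm).trans hle))
      (hφ.coframeDist_zero_one_le_integral_norm hV hK hv x)
  have hspeed := ae_eq_integral_of_integral_sq_le hv.norm (hlength ▸ hle)
  rw [hlength] at hspeed
  refine isKernelGeodesic_of_coframeDist_le (x := fun t => φ t x) hV hK fun s hs t ht hst => ?_
  rw [← intervalIntegral_eq_of_ae_eq_const hspeed hs ht]
  exact hφ.coframeDist_le_integral_norm hV hK hv x hs ht hst

lemma IsKernelGeodesic.norm_minLift_derivWithin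
    (hK : ∀ x : EuclideanSpace ℝ (Fin n), (RKHS.kernel V x x).IsInvertible)
    {x : ℝ → EuclideanSpace ℝ (Fin n)} (hx : IsKernelGeodesic V x₀ x₁ x) {t : ℝ}
    (ht : t ∈ Icc (0 : ℝ) 1) :
    ‖minLift V (x t) (derivWithin x (Icc 0 1) t)‖ = coframeDist (minLift V) x₀ x₁ := by
  rw [coframeDist, ← kernelEDist_eq_coframeEDist hK, ← hx.speed t ht,
    kernelSpeed_eq_enorm_minLift (hK _), toReal_enorm]

theorem IsKernelGeodesic.exists_isFlow_apply_eq
    (hV : EmbedsInBoundedLipschitz V (X := EuclideanSpace ℝ (Fin n)) c)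
    (hK : ∀ x : EuclideanSpace ℝ (Fin n), (RKHS.kernel V x x).IsInvertible)
    {x : ℝ → EuclideanSpace ℝ (Fin n)} (hx : IsKernelGeodesic V x₀ x₁ x) :
    ∃ (v : ℝ → V) (φ : ℝ → EuclideanSpace ℝ (Fin n) ≃ₜ EuclideanSpace ℝ (Fin n)), IsFlow v φ ∧
      MemLp v 2 (volume.restrict (Icc (0 : ℝ) 1)) ∧
      (∫ t in Icc (0 : ℝ) 1, ‖v t‖ ^ 2 = coframeDist (minLift V) x₀ x₁ ^ 2) ∧
      ∀ t ∈ Icc (0 : ℝ) 1, φ t x₀ = x t := by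
  have hderiv := hasContinuousDerivOn_derivWithin (uniqueDiffOn_Icc (zero_lt_one' ℝ)) hx.contDiffOn
  let v : ℝ → V := fun t => minLift V (x t) (derivWithin x (Icc 0 1) t)
  have hvD : ∀ t ∈ Icc (0 : ℝ) 1, ‖v t‖ = coframeDist (minLift V) x₀ x₁ :=
    fun t ht => hx.norm_minLift_derivWithin hK ht
  have hvc : ContinuousOn v (Icc 0 1) :=
    ((hV.locallyLipschitz_minLift hK).continuous.comp_continuousOn
      hderiv.continuousOn).clm_apply hderiv.continuousOn_deriv
  have hcurve : IsIntegralCurveOn x (fun t y => v t y) (Icc 0 1) := fun t ht => by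
    simpa only [v, minLift_apply_self (hK (x t))] using hderiv.hasDerivWithinAt t ht
  obtain ⟨φ, hφ, hφx⟩ := exists_isFlow hV hvc
  refine ⟨v, φ, hφ, ?_, ?_, fun t ht => by rw [← hx.source, hφx x hcurve t ht]⟩
  · exact MemLp.of_bound (hvc.aestronglyMeasurable measurableSet_Icc) _
      (ae_restrict_of_forall_mem measurableSet_Icc fun t ht => (hvD t ht).le)
  · rw [setIntegral_congr_fun measurableSet_Icc fun t ht =>
      congrArg (fun d => d ^ 2) (hvD t ht)]
    simp

end TrajectoryEnergy

section DiracMeasures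

lemma smul_dirac_eq_smul_dirac {α : Type*} [MeasurableSpace α] [MeasurableSingletonClass α]
    {a b : ℝ≥0∞} {x y : α} (h : a • Measure.dirac x = b • Measure.dirac y) :
    a = b ∧ (b ≠ 0 → x = y) := by
  have hab : a = b := by simpa using congrArg (fun μ => μ univ) h
  refine ⟨hab, fun hb => ?_⟩
  by_contra hxy
  have hatom : a • Measure.dirac x {y} = b • Measure.dirac y {y} := congrArg (fun μ => μ {y}) h
  exact hb (by simpa [hxy] using hatom.symm)

lemma memLp_section_of_prod_smul_dirac {α β E : Type*} [MeasurableSpace α] [MeasurableSpace β]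
    [NormedAddCommGroup E] {f : α × β → E} {p : ℝ≥0∞} {μ : Measure α} [SFinite μ] {y : β}
    {r : ℝ≥0∞} (hr : r ≠ 0) (hr' : r ≠ ∞) (hf : MemLp f p (μ.prod (r • Measure.dirac y))) :
    MemLp (fun x => f (x, y)) p μ := by
  rw [Measure.prod_smul_right, Measure.prod_dirac] at hf
  have hf' := hf.smul_measure (ENNReal.inv_ne_top.2 hr)
  rw [smul_smul, ENNReal.inv_mul_cancel hr hr', one_smul] at hf'
  exact hf'.comp_of_map (by fun_prop)

variable {n : ℕ} {r₀ r₁ γ : ℝ} {x₀ x₁ : EuclideanSpace ℝ (Fin n)}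
  {φ : ℝ → EuclideanSpace ℝ (Fin n) ≃ₜ EuclideanSpace ℝ (Fin n)}
  {η : ℝ → EuclideanSpace ℝ (Fin n) → ℝ}

lemma ae_ofReal_smul_dirac_iff (hr₀ : 0 < r₀) {p : EuclideanSpace ℝ (Fin n) → Prop} :
    (∀ᵐ x ∂(ENNReal.ofReal r₀ • Measure.dirac x₀), p x) ↔ p x₀ := by
  rw [Measure.ae_ennreal_smul_measure_eq (ENNReal.ofReal_pos.2 hr₀).ne', ae_dirac_eq,
    eventually_pure]

lemma transformedMeasure_smul_dirac (hr₀ : 0 ≤ r₀) (t : ℝ) :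
    transformedMeasure (ENNReal.ofReal r₀ • Measure.dirac x₀) φ η t =
      ENNReal.ofReal ((√r₀ * sqrtWeight η t x₀) ^ 2) • Measure.dirac (φ t x₀) := by
  rw [transformedMeasure, Measure.map_smul, Measure.map_dirac, withDensity_smul_measure,
    dirac_withDensity, smul_smul, Homeomorph.symm_apply_apply, mul_pow, Real.sq_sqrt hr₀,
    ENNReal.ofReal_mul hr₀]

lemma lddmmFRCost_smul_dirac (hγ : 0 ≤ γ) (hr₀ : 0 ≤ r₀) {W : Type*} [NormedAddCommGroup W]
    {v : ℝ → W} (hv : MemLp v 2 (volume.restrict (Icc (0 : ℝ) 1)))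
    (hη : MemLp (fun t => η t x₀) 2 (volume.restrict (Icc (0 : ℝ) 1))) :
    lddmmFRCost γ (ENNReal.ofReal r₀ • Measure.dirac x₀) v η φ =
      ENNReal.ofReal (1 / 2 * (∫ t in Icc (0 : ℝ) 1, ‖v t‖ ^ 2) +
        γ / 2 * (r₀ * ∫ t in Icc (0 : ℝ) 1, η t x₀ ^ 2)) := by
  have hweight (t : ℝ) : ∫⁻ y, ‖η t ((φ t).symm y)‖ₑ ^ 2
      ∂((ENNReal.ofReal r₀ • Measure.dirac x₀).map (φ t)) =
        ENNReal.ofReal r₀ * ‖η t x₀‖ₑ ^ 2 := by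
    rw [Measure.map_smul, Measure.map_dirac, lintegral_smul_measure, lintegral_dirac,
      Homeomorph.symm_apply_apply, smul_eq_mul]
  have : 0 ≤ ∫ t in Icc (0 : ℝ) 1, ‖v t‖ ^ 2 := integral_nonneg fun _ => by positivity
  have : 0 ≤ ∫ t in Icc (0 : ℝ) 1, η t x₀ ^ 2 := integral_nonneg fun _ => by positivity
  simp only [lddmmFRCost, hweight]
  rw [lintegral_const_mul' _ _ ENNReal.ofReal_ne_top, lintegral_enorm_sq_eq_ofReal hv,
    lintegral_enorm_sq_eq_ofReal hη, ENNReal.ofReal_add (by positivity) (by positivity),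
    ENNReal.ofReal_mul (by positivity), ENNReal.ofReal_mul (by positivity), ENNReal.ofReal_mul hr₀]
  simp only [Real.norm_eq_abs, sq_abs]

variable {V : Type*} [NormedAddCommGroup V] [InnerProductSpace ℝ V]
  [RKHS ℝ V (EuclideanSpace ℝ (Fin n)) (EuclideanSpace ℝ (Fin n))] {c : ℝ≥0} {v : ℝ → V}

lemma IsAdmissible.memLp_section (hr₀ : 0 < r₀) {μ' : Measure (EuclideanSpace ℝ (Fin n))}
    (h : IsAdmissible (ENNReal.ofReal r₀ • Measure.dirac x₀) μ' v η φ) :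
    MemLp (fun t => η t x₀) 2 (volume.restrict (Icc (0 : ℝ) 1)) :=
  memLp_section_of_prod_smul_dirac (ENNReal.ofReal_pos.2 hr₀).ne' ENNReal.ofReal_ne_top h.memLp_η

lemma IsAdmissible.sqrt_mul_sqrtWeight_one (hr₀ : 0 < r₀) (hr₁ : 0 ≤ r₁)
    (h : IsAdmissible (ENNReal.ofReal r₀ • Measure.dirac x₀)
      (ENNReal.ofReal r₁ • Measure.dirac x₁) v η φ) :
    √r₀ * sqrtWeight η 1 x₀ = √r₁ := by
  have htarget := h.target
  rw [transformedMeasure_smul_dirac hr₀.le] at htarget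
  have hmass := (ENNReal.ofReal_eq_ofReal_iff (sq_nonneg _) hr₁).1
    (smul_dirac_eq_smul_dirac htarget).1
  have hweight : 0 ≤ sqrtWeight η 1 x₀ :=
    (ae_ofReal_smul_dirac_iff hr₀).1 h.nonneg 1 (right_mem_Icc.2 zero_le_one)
  rw [← hmass, Real.sqrt_sq (mul_nonneg (Real.sqrt_nonneg _) hweight)]

lemma IsAdmissible.apply_one_eq (hr₀ : 0 ≤ r₀) (hr₁ : 0 < r₁)
    (h : IsAdmissible (ENNReal.ofReal r₀ • Measure.dirac x₀)
      (ENNReal.ofReal r₁ • Measure.dirac x₁) v η φ) : φ 1 x₀ = x₁ := by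
  have htarget := h.target
  rw [transformedMeasure_smul_dirac hr₀] at htarget
  exact (smul_dirac_eq_smul_dirac htarget).2 (ENNReal.ofReal_pos.2 hr₁).ne'

lemma IsAdmissible.four_mul_sq_sqrt_sub_sqrt_le (hr₀ : 0 < r₀) (hr₁ : 0 ≤ r₁)
    (h : IsAdmissible (ENNReal.ofReal r₀ • Measure.dirac x₀)
      (ENNReal.ofReal r₁ • Measure.dirac x₁) v η φ) :
    4 * (√r₁ - √r₀) ^ 2 ≤ r₀ * ∫ t in Icc (0 : ℝ) 1, η t x₀ ^ 2 :=
  calc 4 * (√r₁ - √r₀) ^ 2 = √r₀ ^ 2 * (4 * (sqrtWeight η 1 x₀ - 1) ^ 2) := by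
        rw [← h.sqrt_mul_sqrtWeight_one hr₀ hr₁]
        ring
    _ ≤ r₀ * ∫ t in Icc (0 : ℝ) 1, η t x₀ ^ 2 := by
        rw [Real.sq_sqrt hr₀.le]
        gcongr
        exact four_mul_sq_sqrtWeight_sub_one_le (h.memLp_section hr₀)

lemma IsAdmissible.sqrt_mul_sqrtWeight_of_integral_sq_le (hr₀ : 0 < r₀) (hr₁ : 0 ≤ r₁)
    (h : IsAdmissible (ENNReal.ofReal r₀ • Measure.dirac x₀)
      (ENNReal.ofReal r₁ • Measure.dirac x₁) v η φ)
    (hle : r₀ * ∫ t in Icc (0 : ℝ) 1, η t x₀ ^ 2 ≤ 4 * (√r₁ - √r₀) ^ 2) {t : ℝ}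
    (ht : t ∈ Icc (0 : ℝ) 1) :
    √r₀ * sqrtWeight η t x₀ = (1 - t) * √r₀ + t * √r₁ := by
  have hone := h.sqrt_mul_sqrtWeight_one hr₀ hr₁
  have hle' : ∫ t in Icc (0 : ℝ) 1, η t x₀ ^ 2 ≤ 4 * (sqrtWeight η 1 x₀ - 1) ^ 2 := by
    refine le_of_mul_le_mul_left (hle.trans_eq ?_) hr₀
    nth_rw 2 [← Real.sq_sqrt hr₀.le]
    rw [← hone]
    ring
  rw [sqrtWeight_eq_lineMap_of_integral_sq_le (h.memLp_section hr₀) hle' ht, ← hone,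
    AffineMap.lineMap_apply_ring]
  ring

lemma sqrt_mul_sqrtWeight_const (hr₀ : 0 < r₀) (r₁ t : ℝ) (x : EuclideanSpace ℝ (Fin n)) :
    √r₀ * sqrtWeight (fun _ _ => 2 * (√r₁ / √r₀ - 1)) t x = (1 - t) * √r₀ + t * √r₁ := by
  have : √r₀ ≠ 0 := (Real.sqrt_pos.2 hr₀).ne'
  rw [sqrtWeight_const, AffineMap.lineMap_apply_ring]
  field_simp

lemma isAdmissible_const (hr₀ : 0 < r₀) (hr₁ : 0 ≤ r₁)
    (hv : MemLp v 2 (volume.restrict (Icc (0 : ℝ) 1))) (hφ : IsFlow v φ) :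
    IsAdmissible (ENNReal.ofReal r₀ • Measure.dirac x₀)
      (ENNReal.ofReal r₁ • Measure.dirac (φ 1 x₀)) v (fun _ _ => 2 * (√r₁ / √r₀ - 1)) φ where
  memLp_v := hv
  memLp_η :=
    have := (Measure.dirac x₀).smul_finite (ENNReal.ofReal_ne_top (r := r₀))
    memLp_const _
  flow := hφ
  nonneg := (ae_ofReal_smul_dirac_iff hr₀).2 fun t ht => by
    refine nonneg_of_mul_nonneg_right ?_ (Real.sqrt_pos.2 hr₀)
    rw [sqrt_mul_sqrtWeight_const hr₀]
    have := sub_nonneg.2 ht.2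
    have := ht.1
    positivity
  target := by
    rw [transformedMeasure_smul_dirac hr₀.le, sqrt_mul_sqrtWeight_const hr₀]
    simp [Real.sq_sqrt hr₁]

end DiracMeasures

section LDDMMFRDistance

variable {n : ℕ} {V : Type*} [NormedAddCommGroup V] [InnerProductSpace ℝ V] [CompleteSpace V]
  [RKHS ℝ V (EuclideanSpace ℝ (Fin n)) (EuclideanSpace ℝ (Fin n))] {c : ℝ≥0} {r₀ r₁ γ : ℝ}
  {x₀ x₁ : EuclideanSpace ℝ (Fin n)} {v : ℝ → V} {η : ℝ → EuclideanSpace ℝ (Fin n) → ℝ}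
  {φ : ℝ → EuclideanSpace ℝ (Fin n) ≃ₜ EuclideanSpace ℝ (Fin n)}

lemma IsAdmissible.coframeDist_le (hr₀ : 0 ≤ r₀) (hr₁ : 0 ≤ r₁) (h₁ : r₁ = 0 → x₁ = x₀)
    (h : IsAdmissible (ENNReal.ofReal r₀ • Measure.dirac x₀)
      (ENNReal.ofReal r₁ • Measure.dirac x₁) v η φ) :
    coframeDist (minLift V) x₀ x₁ ≤ coframeDist (minLift V) (φ 0 x₀) (φ 1 x₀) := by
  rcases hr₁.eq_or_lt' with hzero | hpos
  · rw [h₁ hzero, coframeDist_self]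
    exact coframeDist_nonneg
  · rw [h.flow.apply_zero, h.apply_one_eq hr₀ hpos]

lemma IsAdmissible.apply_one_eq_of_coframeDist_le
    (hV : EmbedsInBoundedLipschitz V (X := EuclideanSpace ℝ (Fin n)) c)
    (hK : ∀ x : EuclideanSpace ℝ (Fin n), (RKHS.kernel V x x).IsInvertible)
    (hr₀ : 0 ≤ r₀) (hr₁ : 0 ≤ r₁) (h₁ : r₁ = 0 → x₁ = x₀)
    (h : IsAdmissible (ENNReal.ofReal r₀ • Measure.dirac x₀)
      (ENNReal.ofReal r₁ • Measure.dirac x₁) v η φ)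
    (hle : coframeDist (minLift V) (φ 0 x₀) (φ 1 x₀) ≤ coframeDist (minLift V) x₀ x₁) :
    φ 1 x₀ = x₁ := by
  rcases hr₁.eq_or_lt' with hzero | hpos
  · rw [h₁ hzero, coframeDist_self, h.flow.apply_zero] at hle
    have hnorm := norm_sub_le_mul_coframeDist (hV.locallyLipschitz_minLift hK).continuous
      (fun z => hV.antilipschitzWith_minLift (hK z)) x₀ (φ 1 x₀)
    rw [le_antisymm hle coframeDist_nonneg, mul_zero] at hnorm
    rw [h₁ hzero]
    exact (sub_eq_zero.1 (norm_le_zero_iff.1 hnorm)).symm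
  · exact h.apply_one_eq hr₀ hpos

lemma IsAdmissible.sq_coframeDist_le_integral_norm_sq
    (hV : EmbedsInBoundedLipschitz V (X := EuclideanSpace ℝ (Fin n)) c)
    (hK : ∀ x : EuclideanSpace ℝ (Fin n), (RKHS.kernel V x x).IsInvertible)
    (hr₀ : 0 ≤ r₀) (hr₁ : 0 ≤ r₁) (h₁ : r₁ = 0 → x₁ = x₀)
    (h : IsAdmissible (ENNReal.ofReal r₀ • Measure.dirac x₀)
      (ENNReal.ofReal r₁ • Measure.dirac x₁) v η φ) :
    coframeDist (minLift V) x₀ x₁ ^ 2 ≤ ∫ t in Icc (0 : ℝ) 1, ‖v t‖ ^ 2 :=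
  (pow_le_pow_left₀ coframeDist_nonneg (h.coframeDist_le hr₀ hr₁ h₁) 2).trans
    (h.flow.sq_coframeDist_le_integral_norm_sq hV hK h.memLp_v x₀)

lemma IsAdmissible.isKernelGeodesic_of_integral_norm_sq_le
    (hV : EmbedsInBoundedLipschitz V (X := EuclideanSpace ℝ (Fin n)) c)
    (hK : ∀ x : EuclideanSpace ℝ (Fin n), (RKHS.kernel V x x).IsInvertible)
    (hr₀ : 0 ≤ r₀) (hr₁ : 0 ≤ r₁) (h₁ : r₁ = 0 → x₁ = x₀)
    (h : IsAdmissible (ENNReal.ofReal r₀ • Measure.dirac x₀)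
      (ENNReal.ofReal r₁ • Measure.dirac x₁) v η φ)
    (hle : ∫ t in Icc (0 : ℝ) 1, ‖v t‖ ^ 2 ≤ coframeDist (minLift V) x₀ x₁ ^ 2) :
    IsKernelGeodesic V x₀ x₁ fun t => φ t x₀ := by
  have hdist : coframeDist (minLift V) (φ 0 x₀) (φ 1 x₀) ≤ coframeDist (minLift V) x₀ x₁ :=
    (sq_le_sq₀ coframeDist_nonneg coframeDist_nonneg).1
      ((h.flow.sq_coframeDist_le_integral_norm_sq hV hK h.memLp_v x₀).trans hle)
  have htarget := h.apply_one_eq_of_coframeDist_le hV hK hr₀ hr₁ h₁ hdist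
  have hgeodesic := h.flow.isKernelGeodesic_of_integral_norm_sq_le hV hK h.memLp_v (x := x₀)
    (by rwa [h.flow.apply_zero, htarget])
  rwa [h.flow.apply_zero, htarget] at hgeodesic

theorem IsAdmissible.le_lddmmFRCost
    (hV : EmbedsInBoundedLipschitz V (X := EuclideanSpace ℝ (Fin n)) c)
    (hK : ∀ x : EuclideanSpace ℝ (Fin n), (RKHS.kernel V x x).IsInvertible)
    (hγ : 0 ≤ γ) (hr₀ : 0 < r₀) (hr₁ : 0 ≤ r₁) (h₁ : r₁ = 0 → x₁ = x₀)
    (h : IsAdmissible (ENNReal.ofReal r₀ • Measure.dirac x₀)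
      (ENNReal.ofReal r₁ • Measure.dirac x₁) v η φ) :
    ENNReal.ofReal (1 / 2 * coframeDist (minLift V) x₀ x₁ ^ 2 + 2 * γ * (√r₁ - √r₀) ^ 2) ≤
      lddmmFRCost γ (ENNReal.ofReal r₀ • Measure.dirac x₀) v η φ := by
  rw [lddmmFRCost_smul_dirac hγ hr₀.le h.memLp_v (h.memLp_section hr₀)]
  refine ENNReal.ofReal_le_ofReal (add_le_add ?_ ?_)
  · gcongr
    exact h.sq_coframeDist_le_integral_norm_sq hV hK hr₀.le hr₁ h₁
  · calc 2 * γ * (√r₁ - √r₀) ^ 2 = γ / 2 * (4 * (√r₁ - √r₀) ^ 2) := by ring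
      _ ≤ _ := mul_le_mul_of_nonneg_left (h.four_mul_sq_sqrt_sub_sqrt_le hr₀ hr₁)
        (div_nonneg hγ zero_le_two)

theorem IsAdmissible.eq_geodesic_of_lddmmFRCost_le
    (hV : EmbedsInBoundedLipschitz V (X := EuclideanSpace ℝ (Fin n)) c)
    (hK : ∀ x : EuclideanSpace ℝ (Fin n), (RKHS.kernel V x x).IsInvertible)
    (hγ : 0 < γ) (hr₀ : 0 < r₀) (hr₁ : 0 ≤ r₁) (h₁ : r₁ = 0 → x₁ = x₀)
    (h : IsAdmissible (ENNReal.ofReal r₀ • Measure.dirac x₀)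
      (ENNReal.ofReal r₁ • Measure.dirac x₁) v η φ)
    (hcost : lddmmFRCost γ (ENNReal.ofReal r₀ • Measure.dirac x₀) v η φ ≤
      ENNReal.ofReal (1 / 2 * coframeDist (minLift V) x₀ x₁ ^ 2 + 2 * γ * (√r₁ - √r₀) ^ 2)) :
    (IsKernelGeodesic V x₀ x₁ fun t => φ t x₀) ∧
      ∀ t ∈ Icc (0 : ℝ) 1, transformedMeasure (ENNReal.ofReal r₀ • Measure.dirac x₀) φ η t =
        ENNReal.ofReal (((1 - t) * √r₀ + t * √r₁) ^ 2) • Measure.dirac (φ t x₀) := by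
  rw [lddmmFRCost_smul_dirac hγ.le hr₀.le h.memLp_v (h.memLp_section hr₀),
    ENNReal.ofReal_le_ofReal_iff (by positivity)] at hcost
  have hposition := h.sq_coframeDist_le_integral_norm_sq hV hK hr₀.le hr₁ h₁
  have hweight := mul_le_mul_of_nonneg_left (h.four_mul_sq_sqrt_sub_sqrt_le hr₀ hr₁)
    (half_pos hγ).le
  refine ⟨h.isKernelGeodesic_of_integral_norm_sq_le hV hK hr₀.le hr₁ h₁ (by linarith),
    fun t ht => ?_⟩
  rw [transformedMeasure_smul_dirac hr₀.le, h.sqrt_mul_sqrtWeight_of_integral_sq_le hr₀ hr₁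
    (le_of_mul_le_mul_left (by linarith) (half_pos hγ)) ht]

theorem IsKernelGeodesic.exists_isAdmissible
    (hV : EmbedsInBoundedLipschitz V (X := EuclideanSpace ℝ (Fin n)) c)
    (hK : ∀ x : EuclideanSpace ℝ (Fin n), (RKHS.kernel V x x).IsInvertible)
    (hγ : 0 ≤ γ) (hr₀ : 0 < r₀) (hr₁ : 0 ≤ r₁) {x : ℝ → EuclideanSpace ℝ (Fin n)}
    (hx : IsKernelGeodesic V x₀ x₁ x) :
    ∃ (v : ℝ → V) (η : ℝ → EuclideanSpace ℝ (Fin n) → ℝ)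
      (φ : ℝ → EuclideanSpace ℝ (Fin n) ≃ₜ EuclideanSpace ℝ (Fin n)),
      IsAdmissible (ENNReal.ofReal r₀ • Measure.dirac x₀)
        (ENNReal.ofReal r₁ • Measure.dirac x₁) v η φ ∧
      lddmmFRCost γ (ENNReal.ofReal r₀ • Measure.dirac x₀) v η φ =
        ENNReal.ofReal (1 / 2 * coframeDist (minLift V) x₀ x₁ ^ 2 + 2 * γ * (√r₁ - √r₀) ^ 2) ∧
      ∀ t ∈ Icc (0 : ℝ) 1, transformedMeasure (ENNReal.ofReal r₀ • Measure.dirac x₀) φ η t =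
        ENNReal.ofReal (((1 - t) * √r₀ + t * √r₁) ^ 2) • Measure.dirac (x t) := by
  obtain ⟨v, φ, hφ, hv, henergy, hφx⟩ := hx.exists_isFlow_apply_eq hV hK
  have hadm := isAdmissible_const (x₀ := x₀) hr₀ hr₁ hv hφ
  rw [hφx 1 (right_mem_Icc.2 zero_le_one), hx.target] at hadm
  refine ⟨v, _, φ, hadm, ?_, fun t ht => ?_⟩
  · have hr₀' : √r₀ ≠ 0 := (Real.sqrt_pos.2 hr₀).ne'
    rw [lddmmFRCost_smul_dirac hγ hr₀.le hv (hadm.memLp_section hr₀), henergy, integral_const,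
      probReal_univ, one_smul]
    nth_rw 1 [← Real.sq_sqrt hr₀.le]
    congr 2
    field_simp
  · rw [transformedMeasure_smul_dirac hr₀.le, sqrt_mul_sqrtWeight_const hr₀, hφx t ht]

theorem lddmmFREDist_smul_dirac
    (hV : EmbedsInBoundedLipschitz V (X := EuclideanSpace ℝ (Fin n)) c)
    (hK : ∀ x : EuclideanSpace ℝ (Fin n), (RKHS.kernel V x x).IsInvertible)
    (hγ : 0 ≤ γ) (hr₀ : 0 < r₀) (hr₁ : 0 ≤ r₁) (h₁ : r₁ = 0 → x₁ = x₀) :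
    lddmmFREDist V γ (ENNReal.ofReal r₀ • Measure.dirac x₀)
      (ENNReal.ofReal r₁ • Measure.dirac x₁) =
      ENNReal.ofReal (1 / 2 * coframeDist (minLift V) x₀ x₁ ^ 2 + 2 * γ * (√r₁ - √r₀) ^ 2) ^
        (1 / 2 : ℝ) := by
  obtain ⟨x, hx⟩ := exists_isKernelGeodesic hV hK x₀ x₁
  obtain ⟨v, η, φ, hadm, hcost, -⟩ := hx.exists_isAdmissible hV hK hγ hr₀ hr₁
  rw [lddmmFREDist]
  congr 1
  refine le_antisymm (hcost ▸ iInf₂_le_of_le v η (iInf₂_le φ hadm)) ?_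
  exact le_iInf₂ fun v η => le_iInf₂ fun φ h => h.le_lddmmFRCost hV hK hγ hr₀ hr₁ h₁

end LDDMMFRDistance

theorem mainTheorem6_general {n : ℕ} {V : Type*} [NormedAddCommGroup V] [InnerProductSpace ℝ V]
    [CompleteSpace V] [RKHS ℝ V (EuclideanSpace ℝ (Fin n)) (EuclideanSpace ℝ (Fin n))] {c : ℝ≥0}
    (hV : EmbedsInBoundedLipschitz V (X := EuclideanSpace ℝ (Fin n)) c)
    (hK : ∀ x : EuclideanSpace ℝ (Fin n), (RKHS.kernel V x x).IsInvertible)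
    {γ : ℝ} (hγ : 0 < γ) {r₀ r₁ : ℝ} (hr₀ : 0 < r₀) (hr₁ : 0 ≤ r₁)
    (x₀ x₁ : EuclideanSpace ℝ (Fin n)) (h₁ : r₁ = 0 → x₁ = x₀) :
    (kernelEDist V x₀ x₁ ≠ ∞ ∧
      lddmmFREDist V γ (ENNReal.ofReal r₀ • Measure.dirac x₀)
        (ENNReal.ofReal r₁ • Measure.dirac x₁) ≠ ∞ ∧
      (lddmmFREDist V γ (ENNReal.ofReal r₀ • Measure.dirac x₀)
        (ENNReal.ofReal r₁ • Measure.dirac x₁)).toReal ^ 2 =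
        1 / 2 * (kernelEDist V x₀ x₁).toReal ^ 2 + 2 * γ * (√r₁ - √r₀) ^ 2) ∧
    (∃ x : ℝ → EuclideanSpace ℝ (Fin n), IsKernelGeodesic V x₀ x₁ x) ∧
    ∀ m : ℝ → Measure (EuclideanSpace ℝ (Fin n)),
      IsLDDMMFRGeodesic V γ (ENNReal.ofReal r₀ • Measure.dirac x₀)
        (ENNReal.ofReal r₁ • Measure.dirac x₁) m ↔
      ∃ x : ℝ → EuclideanSpace ℝ (Fin n), IsKernelGeodesic V x₀ x₁ x ∧
        ∀ t ∈ Icc (0 : ℝ) 1,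
          m t = ENNReal.ofReal (((1 - t) * √r₀ + t * √r₁) ^ 2) • Measure.dirac (x t) := by
  have hdist := lddmmFREDist_smul_dirac hV hK hγ.le hr₀ hr₁ h₁
  refine ⟨?_, exists_isKernelGeodesic hV hK x₀ x₁, fun m => ⟨?_, ?_⟩⟩
  · rw [hdist, kernelEDist_eq_coframeEDist hK]
    refine ⟨coframeEDist_ne_top (hV.locallyLipschitz_minLift hK).continuous,
      ENNReal.rpow_ne_top_of_nonneg (by positivity) ENNReal.ofReal_ne_top, ?_⟩
    rw [← ENNReal.toReal_rpow, ENNReal.toReal_ofReal (by positivity), ← Real.sqrt_eq_rpow,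
      Real.sq_sqrt (by positivity), coframeDist]
  · rintro ⟨v, η, φ, hadm, hopt, hm⟩
    rw [hdist, (ENNReal.rpow_left_injective (by norm_num)).eq_iff] at hopt
    obtain ⟨hgeodesic, htrans⟩ :=
      hadm.eq_geodesic_of_lddmmFRCost_le hV hK hγ hr₀ hr₁ h₁ hopt.ge
    exact ⟨_, hgeodesic, fun t ht => (hm t ht).trans (htrans t ht)⟩
  · rintro ⟨x, hx, hm⟩
    obtain ⟨v, η, φ, hadm, hcost, htrans⟩ := hx.exists_isAdmissible hV hK hγ.le hr₀ hr₁
    exact ⟨v, η, φ, hadm, by rw [hdist, hcost], fun t ht => (hm t ht).trans (htrans t ht).symm⟩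

end

theorem mainTheorem6 {n : ℕ} {V : Type*} [NormedAddCommGroup V] [InnerProductSpace ℝ V]
    [CompleteSpace V] [RKHS ℝ V (EuclideanSpace ℝ (Fin n)) (EuclideanSpace ℝ (Fin n))]
    (hV : EmbedsInC20 V)
    (hK : ∀ x : EuclideanSpace ℝ (Fin n), (RKHS.kernel V x x).IsInvertible)
    {γ : ℝ} (hγ : 0 < γ) {r₀ r₁ : ℝ} (hr₀ : 0 < r₀) (hr₁ : 0 ≤ r₁)
    (x₀ x₁ : EuclideanSpace ℝ (Fin n)) (h₁ : r₁ = 0 → x₁ = x₀) :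
    -- the distance
    (kernelEDist V x₀ x₁ ≠ ∞ ∧
      lddmmFREDist V γ (ENNReal.ofReal r₀ • Measure.dirac x₀)
        (ENNReal.ofReal r₁ • Measure.dirac x₁) ≠ ∞ ∧
      (lddmmFREDist V γ (ENNReal.ofReal r₀ • Measure.dirac x₀)
        (ENNReal.ofReal r₁ • Measure.dirac x₁)).toReal ^ 2 =
        1 / 2 * (kernelEDist V x₀ x₁).toReal ^ 2 + 2 * γ * (√r₁ - √r₀) ^ 2) ∧
    -- the geodesics
    (∃ x : ℝ → EuclideanSpace ℝ (Fin n), IsKernelGeodesic V x₀ x₁ x) ∧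
    ∀ m : ℝ → Measure (EuclideanSpace ℝ (Fin n)),
      IsLDDMMFRGeodesic V γ (ENNReal.ofReal r₀ • Measure.dirac x₀)
        (ENNReal.ofReal r₁ • Measure.dirac x₁) m ↔
      ∃ x : ℝ → EuclideanSpace ℝ (Fin n), IsKernelGeodesic V x₀ x₁ x ∧
        ∀ t ∈ Icc (0 : ℝ) 1,
          m t = ENNReal.ofReal (((1 - t) * √r₀ + t * √r₁) ^ 2) • Measure.dirac (x t) := by
  obtain ⟨c, hV'⟩ := hV.exists_embedsInBoundedLipschitz
  exact mainTheorem6_general hV' hK hγ hr₀ hr₁ x₀ x₁ h₁
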